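/- Let $k$ be a non-archimedean local field with ring of integers $\mathcal{O}_k$ and residue field $\mathbb{K}$. Let $E$ be a finite-dimensional central division $k$-algebra, let $\mathcal{O}_E$ be its ring of integers (the elements of $E$ that are integral over $\mathcal{O}_k$), let $m_E$ be the unique maximal two-sided ideal of $\mathcal{O}_E$, and put $\mathbb{E}=\mathcal{O}_E/m_E$. Let $f\ge 1$ and $\mathfrak{D}=M_f(\mathcal{O}_E)\subseteq M_f(E)$. For every (unital) $\mathbb{K}$-subalgebra $\mathbb{H}\subseteq M_f(\mathbb{E})$ there exists an order $\mathfrak{H}\subseteq\mathfrak{D}$ of maximal rank (that is, an $\mathcal{O}_k$-subalgebra of $M_f(E)$ which is finitely generated as an $\mathcal{O}_k$-module and spans $M_f(E)$ over $k$) whose image in $M_f(\mathbb{E})$ under entrywise reduction modulo $m_E$ is exactly $\mathbb{H}$, and whose relative local spinor image $$H_k(\phi,\mathfrak{D}|\mathfrak{H})=\{N(a)\;:\;a\in M_f(E)^*,\ a\,\phi(\mathfrak{H})\,a^{-1}\subseteq\mathfrak{D}\}\subseteq k^*$$ is a subgroup of $k^*$. Here $N$ is the reduced norm $M_f(E)^*\to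 k^*$ and $\phi:k\mathfrak{H}=M_f(E)\to M_f(E)$ is the identity representation. -/

import Mathlib

open ValuativeRel
open scoped TensorProduct

namespace LocalOrders

set_option linter.unusedSectionVars false

section Integers

variable {k : Type*} [Field k] [ValuativeRel k] [TopologicalSpace k]
  [IsNonarchimedeanLocalField k]
  {E : Type*} [DivisionRing E] [Algebra k E] [FiniteDimensional k E]

theorem valuation_norm_le_one_of_isIntegral {x : E} (hx : IsIntegral 𝒪[k] x) :
    valuation k (Algebra.norm k x) ≤ 1 := by
  classical
  obtain ⟨p, hp, hpx⟩ := hx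
  let b := Module.finBasis k E
  let K := AlgebraicClosure k
  let g : E →ₐ[k] Matrix (Fin (Module.finrank k E)) (Fin (Module.finrank k E)) K :=
    ((Algebra.ofId k K).mapMatrix).comp (Algebra.leftMulMatrix b)
  have hg : algebraMap k K (Algebra.norm k x) = (g x).det := by
    rw [Algebra.norm_eq_matrix_det b]
    exact RingHom.map_det (algebraMap k K) _
  have hpg : Polynomial.aeval (g x) p = 0 := by
    have h := Polynomial.aeval_algHom_apply (g.restrictScalars 𝒪[k]) x p
    have h0 : Polynomial.aeval x p = 0 := hpx
    rw [h0, map_zero] at h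
    exact h
  have hdet : IsIntegral 𝒪[k] (g x).det := by
    rw [Matrix.det_eq_prod_roots_charpoly]
    refine IsIntegral.multiset_prod fun μ hμ ↦ ⟨p, hp, ?_⟩
    have hμ' : μ ∈ spectrum K (g x) := by
      rw [Matrix.mem_spectrum_iff_isRoot_charpoly]
      exact (Polynomial.mem_roots'.1 hμ).2
    have h1 := spectrum.subset_polynomial_aeval (g x) (p.map (algebraMap 𝒪[k] K))
      ⟨μ, hμ', rfl⟩
    have h2 : Polynomial.aeval (g x) (p.map (algebraMap 𝒪[k] K)) = 0 := by
      rw [Polynomial.aeval_map_algebraMap, hpg]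
    rw [h2] at h1
    by_contra hne
    apply h1
    have h3 : (p.map (algebraMap 𝒪[k] K)).eval μ ≠ 0 := by
      rwa [Polynomial.eval_map]
    rw [spectrum.mem_resolventSet_iff, sub_zero]
    exact (IsUnit.mk0 _ h3).map (algebraMap K (Matrix (Fin (Module.finrank k E))
      (Fin (Module.finrank k E)) K))
  rw [← hg] at hdet
  have hk : IsIntegral 𝒪[k] (Algebra.norm k x) :=
    (isIntegral_algebraMap_iff (algebraMap k K).injective).1 hdet
  obtain ⟨y, hy⟩ := IsIntegrallyClosed.isIntegral_iff.1 hk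
  rw [← hy]
  exact y.2

variable (k E) in
theorem exists_coord_bound (b : Module.Basis (Fin (Module.finrank k E)) k E) :
    ∃ C : k, C ≠ 0 ∧ ∀ x : E, valuation k (Algebra.norm k x) ≤ 1 →
      ∀ i, valuation k (b.repr x i) ≤ valuation k C := by
  classical
  let m := Module.finrank k E
  have hT2 : T2Space k := by
    let := IsTopologicalAddGroup.rightUniformSpace k
    have := isUniformAddGroup_of_addCommGroup (G := k)
    infer_instance
  let B : Set (Fin m → k) := Set.pi Set.univ fun _ ↦ {a : k | valuation k a ≤ 1}
  have hB : IsCompact B :=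
    isCompact_univ_pi fun _ ↦ IsNonarchimedeanLocalField.isCompact_closedBall k 1
  let T : Set (Fin m → k) := ⋃ i, {c | c i = 1}
  have hT : IsClosed T :=
    isClosed_iUnion_of_finite fun i ↦ isClosed_eq (continuous_apply i) continuous_const
  let F : (Fin m → k) → k := fun c ↦ (∑ i, c i • Algebra.leftMulMatrix b (b i)).det
  have hF : Continuous F := by
    refine Continuous.matrix_det ?_
    refine continuous_finsetSum _ fun i _ ↦ ?_
    exact (continuous_apply i).smul continuous_const
  have hFn : ∀ c, F c = Algebra.norm k (∑ i, c i • b i) := fun c ↦ by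
    rw [Algebra.norm_eq_matrix_det b, map_sum]
    simp only [map_smul, F]
  have hclosed : IsClosed (F '' (B ∩ T)) := ((hB.inter_right hT).image hF).isClosed
  have h0 : (0 : k) ∉ F '' (B ∩ T) := by
    rintro ⟨c, ⟨-, hc⟩, hc0⟩
    obtain ⟨i, hi⟩ := Set.mem_iUnion.1 hc
    have hi' : c i = 1 := hi
    rw [hFn] at hc0
    have hne : ∑ i, c i • b i ≠ 0 := by
      intro h
      have := congrArg (fun x ↦ b.repr x i) h
      rw [b.repr_sum_self] at this
      simp [hi'] at this
    have := (Algebra.norm k).map_mul (∑ i, c i • b i) (∑ i, c i • b i)⁻¹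
    rw [mul_inv_cancel₀ hne, hc0, zero_mul, map_one] at this
    exact one_ne_zero this
  obtain ⟨γ, hγ, hγF⟩ := (IsValuativeTopology.hasBasis_nhds_zero' k).mem_iff.1
    (hclosed.isOpen_compl.mem_nhds h0)
  obtain ⟨d, rfl⟩ := ValuativeRel.valuation_surjective γ
  have hd : d ≠ 0 := by
    rintro rfl
    simp at hγ
  have key : ∀ x : E, valuation k (Algebra.norm k x) ≤ 1 → ∀ i,
      valuation k (b.repr x i) ≤ max 1 (valuation k d⁻¹) := by
    intro x hx i
    have : Nonempty (Fin m) := ⟨i⟩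
    obtain ⟨j, hj⟩ := Finite.exists_max fun i ↦ valuation k (b.repr x i)
    refine (hj i).trans ?_
    by_cases hj0 : b.repr x j = 0
    · simp [hj0]
    have hmem : (fun i ↦ (b.repr x j)⁻¹ * b.repr x i) ∈ B ∩ T := by
      refine ⟨fun i _ ↦ ?_, Set.mem_iUnion.2 ⟨j, inv_mul_cancel₀ hj0⟩⟩
      have hv : valuation k (b.repr x j) ≠ 0 := by simpa using hj0
      change valuation k ((b.repr x j)⁻¹ * b.repr x i) ≤ 1
      rw [map_mul, map_inv₀]
      exact inv_mul_le_one_of_le₀ (hj i) zero_le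
    have hge : valuation k d ≤ valuation k (F fun i ↦ (b.repr x j)⁻¹ * b.repr x i) := by
      by_contra hlt
      exact hγF (not_le.1 hlt) ⟨_, hmem, rfl⟩
    have hx' : ∑ i, ((b.repr x j)⁻¹ * b.repr x i) • b i
        = algebraMap k E (b.repr x j)⁻¹ * x := by
      rw [← Algebra.smul_def]
      simp_rw [mul_smul]
      rw [← Finset.smul_sum, b.sum_repr]
    rw [hFn, hx', map_mul, map_mul, Algebra.norm_algebraMap, map_pow, map_inv₀] at hge
    have hge' : valuation k d ≤ (valuation k (b.repr x j))⁻¹ ^ m :=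
      hge.trans (mul_le_of_le_one_right' hx)
    rcases le_or_gt (valuation k (b.repr x j)) 1 with h1 | h1
    · exact le_max_of_le_left h1
    · refine le_max_of_le_right ?_
      have hm : m ≠ 0 := fun h ↦ (h ▸ j : Fin 0).elim0
      have h2 : valuation k (b.repr x j) ≤ valuation k (b.repr x j) ^ m :=
        le_self_pow₀ h1.le hm
      refine h2.trans ?_
      rw [map_inv₀]
      rw [inv_pow] at hge'
      exact (le_inv_comm₀ (by simpa [zero_lt_iff] using hd)
        (pow_pos (zero_lt_one.trans h1) m)).1 hge'
  rcases le_total 1 (valuation k d⁻¹) with h | h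
  · exact ⟨d⁻¹, inv_ne_zero hd, fun x hx i ↦ (key x hx i).trans (by rw [max_eq_right h])⟩
  · exact ⟨1, one_ne_zero, fun x hx i ↦ (key x hx i).trans (by rw [max_eq_left h, map_one])⟩

theorem isIntegral_of_valuation_norm_le_one {x : E}
    (hx : valuation k (Algebra.norm k x) ≤ 1) : IsIntegral 𝒪[k] x := by
  classical
  let b := Module.finBasis k E
  obtain ⟨C, hC, hb⟩ := exists_coord_bound k E b
  let P : Submodule 𝒪[k] E := Submodule.span 𝒪[k] (Set.range fun i ↦ C • b i)
  have hP : P.FG := Submodule.fg_span (Set.finite_range _)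
  have hmem : ∀ y : E, valuation k (Algebra.norm k y) ≤ 1 → y ∈ P := by
    intro y hy
    rw [← b.sum_repr y]
    refine Submodule.sum_mem _ fun i _ ↦ ?_
    have hv : valuation k (C⁻¹ * b.repr y i) ≤ 1 := by
      rw [map_mul, map_inv₀]
      exact inv_mul_le_one_of_le₀ (hb y hy i) zero_le
    have : b.repr y i • b i = (⟨C⁻¹ * b.repr y i, hv⟩ : 𝒪[k]) • (C • b i) := by
      change _ = (C⁻¹ * b.repr y i) • (C • b i)
      rw [smul_smul]
      congr 1
      field_simp
    rw [this]
    exact Submodule.smul_mem _ _ (Submodule.subset_span ⟨i, rfl⟩)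
  have hle : Subalgebra.toSubmodule (Algebra.adjoin 𝒪[k] {x}) ≤ P := by
    rw [Algebra.adjoin_eq_span, Submodule.span_le]
    intro y hy
    obtain ⟨n, rfl⟩ := Submonoid.mem_closure_singleton.1 hy
    refine hmem _ ?_
    rw [map_pow, map_pow]
    exact pow_le_one₀ zero_le hx
  have : IsNoetherian 𝒪[k] P := isNoetherian_of_fg_of_noetherian P hP
  refine IsIntegral.of_mem_of_fg (Algebra.adjoin 𝒪[k] {x}) ?_ x
    (Algebra.subset_adjoin rfl)
  exact (isNoetherian_submodule.1 this) _ hle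

/-- An element of `E` is integral over `𝒪[k]` iff its norm to `k` is integral. -/
theorem isIntegral_iff_valuation_norm_le_one {x : E} :
    IsIntegral 𝒪[k] x ↔ valuation k (Algebra.norm k x) ≤ 1 :=
  ⟨valuation_norm_le_one_of_isIntegral, isIntegral_of_valuation_norm_le_one⟩

theorem valuation_norm_inv (x : E) :
    valuation k (Algebra.norm k x⁻¹) = (valuation k (Algebra.norm k x))⁻¹ := by
  by_cases hx : x = 0
  · subst hx
    have h : Algebra.norm k (0 : E) = 0 := Algebra.norm_zero
    simp [h]
  · refine eq_inv_of_mul_eq_one_left ?_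
    rw [← map_mul, ← map_mul, inv_mul_cancel₀ hx, map_one, map_one]

theorem valuation_norm_add_le (x y : E) :
    valuation k (Algebra.norm k (x + y)) ≤
      max (valuation k (Algebra.norm k x)) (valuation k (Algebra.norm k y)) := by
  wlog h : valuation k (Algebra.norm k y) ≤ valuation k (Algebra.norm k x) generalizing x y
  · rw [add_comm, max_comm]
    exact this y x (le_of_not_ge h)
  by_cases hx : x = 0
  · simp [hx]
  have h1 : valuation k (Algebra.norm k (x⁻¹ * y)) ≤ 1 := by
    rw [map_mul, map_mul, valuation_norm_inv]
    exact inv_mul_le_one_of_le₀ h zero_le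
  have h2 : valuation k (Algebra.norm k (1 + x⁻¹ * y)) ≤ 1 := by
    obtain ⟨p, hp, hpz⟩ := isIntegral_of_valuation_norm_le_one h1
    refine valuation_norm_le_one_of_isIntegral ?_
    refine IsIntegral.of_mem_of_fg (Algebra.adjoin 𝒪[k] {x⁻¹ * y})
      (IsIntegral.fg_adjoin_singleton ⟨p, hp, hpz⟩) _ ?_
    exact add_mem (one_mem _) (Algebra.subset_adjoin rfl)
  have h3 : x + y = x * (1 + x⁻¹ * y) := by
    rw [mul_add, mul_one, mul_inv_cancel_left₀ hx]
  rw [h3, map_mul, map_mul]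
  exact le_max_of_le_left (mul_le_of_le_one_right' h2)

variable (k E) in
/-- The ring of integers `𝒪_E` of the division algebra `E`: all elements of `E` that are integral
over `𝒪[k]`. -/
def divisionIntegers : Subalgebra 𝒪[k] E where
  carrier := {x | IsIntegral 𝒪[k] x}
  mul_mem' {x y} hx hy := by
    rw [Set.mem_ofPred_eq, isIntegral_iff_valuation_norm_le_one] at *
    rw [map_mul, map_mul]
    exact mul_le_one' hx hy
  add_mem' {x y} hx hy := by
    rw [Set.mem_ofPred_eq, isIntegral_iff_valuation_norm_le_one] at *
    exact (valuation_norm_add_le x y).trans (max_le hx hy)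
  algebraMap_mem' r := isIntegral_algebraMap

theorem mem_divisionIntegers {x : E} : x ∈ divisionIntegers k E ↔ IsIntegral 𝒪[k] x := Iff.rfl

theorem isUnit_divisionIntegers_iff {x : divisionIntegers k E} :
    IsUnit x ↔ valuation k (Algebra.norm k (x : E)) = 1 := by
  constructor
  · rintro ⟨u, rfl⟩
    have h1 := isIntegral_iff_valuation_norm_le_one.1 (u : divisionIntegers k E).2
    have h2 := isIntegral_iff_valuation_norm_le_one.1 (↑u⁻¹ : divisionIntegers k E).2
    have h3 : ((u : divisionIntegers k E) : E) * ((↑u⁻¹ : divisionIntegers k E) : E) = 1 :=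
      congrArg Subtype.val u.mul_inv
    have h4 := congrArg (fun z ↦ valuation k (Algebra.norm k z)) h3
    simp only [map_mul, map_one] at h4
    refine le_antisymm h1 ?_
    rw [← h4]
    exact mul_le_of_le_one_right' h2
  · intro h
    have hx : (x : E) ≠ 0 := by
      intro h0
      have h' : Algebra.norm k (0 : E) = 0 := Algebra.norm_zero
      rw [h0, h', map_zero] at h
      exact zero_ne_one h
    have hi : (x : E)⁻¹ ∈ divisionIntegers k E := by
      rw [mem_divisionIntegers, isIntegral_iff_valuation_norm_le_one, valuation_norm_inv, h,
        inv_one]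
    exact ⟨⟨x, ⟨_, hi⟩, Subtype.ext (mul_inv_cancel₀ hx), Subtype.ext (inv_mul_cancel₀ hx)⟩, rfl⟩

theorem not_isUnit_divisionIntegers_iff {x : divisionIntegers k E} :
    ¬ IsUnit x ↔ valuation k (Algebra.norm k (x : E)) < 1 := by
  rw [isUnit_divisionIntegers_iff]
  exact ⟨lt_of_le_of_ne (isIntegral_iff_valuation_norm_le_one.1 x.2), ne_of_lt⟩

variable (k E) in
/-- The maximal two-sided ideal `m_E` of `𝒪_E`, which consists of the non-units of `𝒪_E`. -/
def divisionMaximalIdeal : Ideal (divisionIntegers k E) where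
  carrier := {x | ¬ IsUnit x}
  zero_mem' := not_isUnit_zero
  add_mem' {x y} hx hy := by
    rw [Set.mem_ofPred_eq, not_isUnit_divisionIntegers_iff] at *
    exact (valuation_norm_add_le (x : E) y).trans_lt (max_lt hx hy)
  smul_mem' c x hx := by
    rw [Set.mem_ofPred_eq, not_isUnit_divisionIntegers_iff] at *
    change valuation k (Algebra.norm k ((c : E) * x)) < 1
    rw [map_mul, map_mul]
    exact (mul_le_of_le_one_left' (isIntegral_iff_valuation_norm_le_one.1 c.2)).trans_lt hx

theorem mem_divisionMaximalIdeal {x : divisionIntegers k E} :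
    x ∈ divisionMaximalIdeal k E ↔ ¬ IsUnit x := Iff.rfl

instance : (divisionMaximalIdeal k E).IsTwoSided where
  mul_mem_of_left {x} c hx := by
    rw [mem_divisionMaximalIdeal, not_isUnit_divisionIntegers_iff] at *
    change valuation k (Algebra.norm k ((x : E) * c)) < 1
    rw [map_mul, map_mul]
    exact (mul_le_of_le_one_right' (isIntegral_iff_valuation_norm_le_one.1 c.2)).trans_lt hx

/-- `m_E` is a proper ideal which contains every proper (in particular every proper two-sided)
ideal of `𝒪_E`, so it is the unique maximal two-sided ideal. -/
theorem ne_top_iff_le_divisionMaximalIdeal (I : Ideal (divisionIntegers k E)) :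
    I ≠ ⊤ ↔ I ≤ divisionMaximalIdeal k E :=
  ⟨fun hI _ hx hu ↦ hI (Ideal.eq_top_of_isUnit_mem I hx hu),
    fun hI h ↦ hI (h ▸ Submodule.mem_top : (1 : divisionIntegers k E) ∈ I) isUnit_one⟩

variable (k E) in
/-- The residue ring `𝔼 = 𝒪_E / m_E`. -/
abbrev ResidueAlgebra : Type _ := divisionIntegers k E ⧸ divisionMaximalIdeal k E

/-- The maximal ideal of `𝒪[k]` acts as zero on `𝔼`. Hence the `𝒪[k]`-subalgebras of a matrix
algebra over `𝔼` are exactly its subalgebras over the residue field `𝓀[k]`. -/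
theorem smul_residueAlgebra_eq_zero {r : 𝒪[k]} (hr : r ∈ 𝓂[k]) (x : ResidueAlgebra k E) :
    r • x = 0 := by
  obtain ⟨y, rfl⟩ := Ideal.Quotient.mk_surjective x
  have hr' : valuation k (r : k) < 1 := by
    refine lt_of_le_of_ne r.2 fun h1 ↦ ?_
    exact (IsLocalRing.mem_maximalIdeal r).1 hr
      ((Valuation.integer.integers (valuation k)).isUnit_iff_valuation_eq_one.2 h1)
  have h : algebraMap 𝒪[k] (divisionIntegers k E) r ∈ divisionMaximalIdeal k E := by
    rw [mem_divisionMaximalIdeal, not_isUnit_divisionIntegers_iff]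
    change valuation k (Algebra.norm k (algebraMap k E (r : k))) < 1
    rw [Algebra.norm_algebraMap, map_pow]
    exact pow_lt_one₀ zero_le hr' Module.finrank_pos.ne'
  rw [Algebra.smul_def]
  change Ideal.Quotient.mk (divisionMaximalIdeal k E) (algebraMap 𝒪[k] _ r) * _ = 0
  rw [Ideal.Quotient.eq_zero_iff_mem.2 h, zero_mul]

end Integers

section MatrixOrders

variable (k : Type*) [Field k] [ValuativeRel k] [TopologicalSpace k]
  [IsNonarchimedeanLocalField k]
  (E : Type*) [DivisionRing E] [Algebra k E] [FiniteDimensional k E] (f : ℕ)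

/-- The inclusion of `M_f(𝒪_E)` in `M_f(E)`. -/
noncomputable def matrixInclusion :
    Matrix (Fin f) (Fin f) (divisionIntegers k E) →ₐ[𝒪[k]] Matrix (Fin f) (Fin f) E :=
  (divisionIntegers k E).val.mapMatrix

/-- Entrywise reduction modulo `m_E`, from `M_f(𝒪_E)` to `M_f(𝔼)`. -/
noncomputable def matrixReduction :
    Matrix (Fin f) (Fin f) (divisionIntegers k E) →ₐ[𝒪[k]]
      Matrix (Fin f) (Fin f) (ResidueAlgebra k E) :=
  (Ideal.Quotient.mkₐ 𝒪[k] (divisionMaximalIdeal k E)).mapMatrix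

/-- The order `𝔇 = M_f(𝒪_E)`, as a subring of `M_f(E)`. -/
noncomputable def matrixOrder : Subalgebra 𝒪[k] (Matrix (Fin f) (Fin f) E) :=
  (matrixInclusion k E f).range

variable {k E f} in
/-- The image in `M_f(𝔼)` of a subring `H` of `M_f(𝒪_E)`. -/
noncomputable def residualImage (H : Subalgebra 𝒪[k] (Matrix (Fin f) (Fin f) E)) :
    Subalgebra 𝒪[k] (Matrix (Fin f) (Fin f) (ResidueAlgebra k E)) :=
  (H.comap (matrixInclusion k E f)).map (matrixReduction k E f)

end MatrixOrders

section Orders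

variable {k : Type*} [Field k] [ValuativeRel k]

/-- `H` is a (local) order of maximal rank in the `k`-algebra `A`: a subring which contains
`𝒪[k]`, is finitely generated as an `𝒪[k]`-module, and spans `A` over `k`. -/
structure IsLocalOrder {A : Type*} [Ring A] [Algebra k A] (H : Subalgebra 𝒪[k] A) : Prop where
  fg : (Subalgebra.toSubmodule H).FG
  span_eq_top : Submodule.span k (H : Set A) = ⊤

/-- `r` is the reduced norm of the element `a` of the central simple `k`-algebra `A`: the
determinant of the matrix of `a` under a splitting of `A` over an algebraic closure of `k`. -/
def IsReducedNorm {k : Type*} [Field k] {A : Type*} [Ring A] [Algebra k A] (a : A) (r : k) :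
    Prop :=
  ∃ (n : ℕ) (e : AlgebraicClosure k ⊗[k] A ≃ₐ[AlgebraicClosure k]
      Matrix (Fin n) (Fin n) (AlgebraicClosure k)),
    (e (1 ⊗ₜ[k] a)).det = algebraMap k (AlgebraicClosure k) r

/-- The relative local spinor image `H_k(φ, D | H)`: all reduced norms of invertible elements `a`
of `A` such that `a φ(H) a⁻¹ ⊆ D`. -/
def localSpinorImage {L A : Type*} [Ring L] [Algebra k L] [Ring A] [Algebra k A]
    (φ : L →ₐ[k] A) (D : Subalgebra 𝒪[k] A) (H : Subalgebra 𝒪[k] L) : Set kˣ :=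
  {r | ∃ a : Aˣ, IsReducedNorm (a : A) (r : k) ∧
    ∀ h ∈ H, (a : A) * φ h * ((a⁻¹ : Aˣ) : A) ∈ D}

end Orders

end LocalOrders

namespace LocalOrders

/-! ### Splitting of central simple algebras and the reduced norm -/

section Splitting

variable {k : Type*} [Field k]

/-! Let `ℍ` act on row vectors over the residue division ring `𝔼`, and let `Γ ⊆ ℤ` be the group
generated by the dimensions of all `ℍ`-invariant subspaces. The order is chosen so that the reduced
norms in question are exactly the products of a reduced norm from `GL_f(𝒪_E)` and a power, with
exponent in `Γ`, of the reduced norm of `diag(π, 1, …, 1)`, where `π` is a uniformizer of `E`. Such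
products form a group.

Upper bound, valid for any order with image `ℍ`: by elementary divisors `a = U π^e V` with `U`, `V`
in `GL_f(𝒪_E)` and `π^e` diagonal (`exists_eq_mul_diagonalUnits_mul`). If `a` conjugates the order
into `𝔇`, then after conjugation by `V` mod `m_E` the entries of `ℍ` at places `e i < e j` vanish.
So the rows of `V` with `e i ≤ c` span an invariant subspace for every `c`, and `∑ e i` is an
integral combination of the dimensions of these subspaces (`sum_mem_of_card_mem`).

Lower bound: by the modular law, the dimensions in a single maximal invariant flag already generate
`Γ` (`finrank_mem_closure_of_maximal_chain`). Each `t ∈ Γ` is a sum of weights `e` that are monotone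
along this flag, with oscillation bounded by one `N` for all `t` (`exists_monotone_weights`). Let
the order consist of the integral matrices with reduction in `ℍ` which, in a lift `C` of a basis
adapted to the flag, are block triangular up to valuation `π ^ N` (`flagOrder`). Then `C⁻¹ π^e C`
conjugates it into `𝔇`, while its image is still all of `ℍ`. -/

theorem equivFinsuppOfBasisLeft_includeRight_mul {L A ι : Type*} [Field L] [Algebra k L] [Ring A]
    [Algebra k A] [DecidableEq ι] (b : Module.Basis ι k L) (a : A) (x : L ⊗[k] A) (i : ι) :
    TensorProduct.equivFinsuppOfBasisLeft b ((1 ⊗ₜ[k] a) * x) i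
      = a * TensorProduct.equivFinsuppOfBasisLeft b x i := by
  induction x using TensorProduct.induction_on with
  | zero => simp
  | tmul l c => simp
  | add x y hx hy => rw [mul_add, map_add, map_add, Finsupp.add_apply, Finsupp.add_apply, hx, hy,
      mul_add]

theorem equivFinsuppOfBasisLeft_mul_includeRight {L A ι : Type*} [Field L] [Algebra k L] [Ring A]
    [Algebra k A] [DecidableEq ι] (b : Module.Basis ι k L) (a : A) (x : L ⊗[k] A) (i : ι) :
    TensorProduct.equivFinsuppOfBasisLeft b (x * (1 ⊗ₜ[k] a)) i
      = TensorProduct.equivFinsuppOfBasisLeft b x i * a := by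
  induction x using TensorProduct.induction_on with
  | zero => simp
  | tmul l c => simp
  | add x y hx hy => rw [add_mul, map_add, map_add, Finsupp.add_apply, Finsupp.add_apply, hx, hy,
      add_mul]

/-- An extension of scalars of a central simple algebra is simple. -/
theorem isSimpleRing_tensorProduct (L A : Type*) [Field L] [Algebra k L] [Ring A]
    [Algebra k A] [IsSimpleRing A] [Algebra.IsCentral k A] : IsSimpleRing (L ⊗[k] A) := by
  classical
  let b := Module.Basis.ofVectorSpace k L
  let c := TensorProduct.equivFinsuppOfBasisLeft (N := A) b
  have hcl : ∀ a x i, c ((1 ⊗ₜ[k] a) * x) i = a * c x i :=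
    equivFinsuppOfBasisLeft_includeRight_mul b
  have hcr : ∀ a x i, c (x * (1 ⊗ₜ[k] a)) i = c x i * a :=
    equivFinsuppOfBasisLeft_mul_includeRight b
  have : Nontrivial (L ⊗[k] A) := by
    have := b.index_nonempty
    exact c.toEquiv.nontrivial
  refine ⟨⟨fun I ↦ or_iff_not_imp_left.2 fun hI ↦ ?_⟩⟩
  rw [← TwoSidedIdeal.one_mem_iff]
  obtain ⟨x₀, hx₀I, hx₀⟩ : ∃ x ∈ I, x ≠ 0 := by
    by_contra! h
    refine hI (le_antisymm (fun x hx ↦ ?_) bot_le)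
    rw [TwoSidedIdeal.mem_bot]
    exact h x hx
  -- The shortest-element argument: `x` has the fewest nonzero coordinates among the nonzero
  -- elements of `I`.
  obtain ⟨x, ⟨hxI, hx0⟩, hmin⟩ := (measure fun x ↦ (c x).support.card).wf.has_min
    {x | x ∈ I ∧ x ≠ 0} ⟨x₀, hx₀I, hx₀⟩
  obtain ⟨i, hi⟩ : (c x).support.Nonempty := by
    rw [Finsupp.support_nonempty_iff]
    simpa using hx0
  -- The coordinate maps are `A`-bilinear, so the `i`-th coordinates of the elements of `I`
  -- supported in the support of `x` form an ideal of `A`. It is nonzero, hence contains `1`.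
  let J : TwoSidedIdeal A := TwoSidedIdeal.mk'
    {a | ∃ y ∈ I, (c y).support ⊆ (c x).support ∧ c y i = a}
    ⟨0, I.zero_mem, by simp, by simp⟩
    (by
      rintro _ _ ⟨y, hy, hys, rfl⟩ ⟨z, hz, hzs, rfl⟩
      refine ⟨y + z, I.add_mem hy hz, ?_, by simp⟩
      rw [map_add]
      exact Finsupp.support_add.trans (Finset.union_subset hys hzs))
    (by
      rintro _ ⟨y, hy, hys, rfl⟩
      exact ⟨-y, I.neg_mem hy, by simpa using hys, by simp⟩)
    (by
      rintro a _ ⟨y, hy, hys, rfl⟩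
      refine ⟨(1 ⊗ₜ[k] a) * y, I.mul_mem_left _ _ hy, fun j hj ↦ hys ?_, hcl _ _ _⟩
      rw [Finsupp.mem_support_iff, hcl] at hj
      exact Finsupp.mem_support_iff.2 (right_ne_zero_of_mul hj))
    (by
      rintro _ a ⟨y, hy, hys, rfl⟩
      refine ⟨y * (1 ⊗ₜ[k] a), I.mul_mem_right _ _ hy, fun j hj ↦ hys ?_, hcr _ _ _⟩
      rw [Finsupp.mem_support_iff, hcr] at hj
      exact Finsupp.mem_support_iff.2 (left_ne_zero_of_mul hj))
  have hmemJ : ∀ a, a ∈ J ↔ ∃ y ∈ I, (c y).support ⊆ (c x).support ∧ c y i = a := fun a ↦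
    TwoSidedIdeal.mem_mk' _ _ _ _ _ _ _
  obtain ⟨y, hyI, hys, hy1⟩ := (hmemJ 1).1 (IsSimpleRing.one_mem_of_ne_bot J (by
    rintro hJ
    have : c x i ∈ J := (hmemJ _).2 ⟨x, hxI, subset_rfl, rfl⟩
    rw [hJ, TwoSidedIdeal.mem_bot] at this
    exact Finsupp.mem_support_iff.1 hi this))
  have hcomm : ∀ j, ∃ r : k, algebraMap k A r = c y j := by
    intro j
    have : c y j ∈ Subalgebra.center k A := by
      rw [Subalgebra.mem_center_iff]
      intro a
      -- The coordinate of `y` at `i` is `1`, so this commutator loses the place `i` and is shorter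
      -- than `x`. By minimality it vanishes, and all coordinates of `y` are central.
      have hz : (1 ⊗ₜ[k] a) * y - y * (1 ⊗ₜ[k] a) = 0 := by
        by_contra hne
        refine hmin _ ⟨I.sub_mem (I.mul_mem_left _ _ hyI) (I.mul_mem_right _ _ hyI), hne⟩
          (Finset.card_lt_card ((Finset.ssubset_iff_of_subset fun l hl ↦ ?_).2 ⟨i, hi, ?_⟩))
        · rw [Finsupp.mem_support_iff, map_sub, Finsupp.sub_apply, hcl, hcr] at hl
          refine hys (Finsupp.mem_support_iff.2 fun h0 ↦ hl ?_)
          rw [h0, mul_zero, zero_mul, sub_zero]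
        · rw [Finsupp.mem_support_iff, map_sub, Finsupp.sub_apply, hcl, hcr, hy1]
          simp
      have := congrArg (fun z ↦ c z j) hz
      simp only [map_sub, Finsupp.sub_apply, hcl, hcr, map_zero, Finsupp.zero_apply] at this
      exact sub_eq_zero.1 this
    exact Algebra.mem_bot.1 (Algebra.IsCentral.out this)
  choose r hr using hcomm
  have hyl : ∃ l : L, y = l ⊗ₜ[k] 1 := by
    refine ⟨∑ j ∈ (c y).support, r j • b j, c.injective (Finsupp.ext fun j ↦ ?_)⟩
    rw [TensorProduct.equivFinsuppOfBasisLeft_apply_tmul_apply]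
    rw [map_sum, Finsupp.finsetSum_apply]
    simp only [map_smul, Finsupp.smul_apply, Module.Basis.repr_self, Finsupp.single_apply,
      smul_eq_mul, mul_ite, mul_one, mul_zero, Finset.sum_ite_eq']
    split_ifs with hj
    · rw [← hr, Algebra.algebraMap_eq_smul_one]
    · rw [zero_smul]
      exact Finsupp.notMem_support_iff.1 hj
  obtain ⟨l, rfl⟩ := hyl
  have hl : l ≠ 0 := by
    rintro rfl
    simp at hy1
  have := I.mul_mem_left (l⁻¹ ⊗ₜ[k] 1) _ hyI
  rwa [Algebra.TensorProduct.tmul_mul_tmul, inv_mul_cancel₀ hl, one_mul,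
    ← Algebra.TensorProduct.one_def] at this

variable (k) in
/-- A central simple algebra splits over an algebraic closure. -/
theorem exists_splitting (A : Type*) [Ring A] [Algebra k A] [IsSimpleRing A]
    [Algebra.IsCentral k A] [FiniteDimensional k A] :
    ∃ n : ℕ, Nonempty (AlgebraicClosure k ⊗[k] A ≃ₐ[AlgebraicClosure k]
      Matrix (Fin n) (Fin n) (AlgebraicClosure k)) := by
  have := isSimpleRing_tensorProduct (k := k) (AlgebraicClosure k) A
  obtain ⟨n, -, h⟩ := IsSimpleRing.exists_algEquiv_matrix_of_isAlgClosed (AlgebraicClosure k)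
    (AlgebraicClosure k ⊗[k] A)
  exact ⟨n, h⟩

variable (k) in
/-- The reduced norm of a central simple algebra is induced by a homomorphism of its unit group
to the multiplicative group of the algebraic closure of the base field. -/
theorem exists_unitsHom_isReducedNorm_iff (A : Type*) [Ring A] [Algebra k A] [IsSimpleRing A]
    [Algebra.IsCentral k A] [FiniteDimensional k A] :
    ∃ ν : Aˣ →* (AlgebraicClosure k)ˣ, ∀ (a : Aˣ) (r : kˣ),
      IsReducedNorm (a : A) (r : k) ↔
        ν a = Units.map (algebraMap k (AlgebraicClosure k)).toMonoidHom r := by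
  obtain ⟨n, ⟨e⟩⟩ := exists_splitting k A
  -- The values are left in the algebraic closure. It need not be shown that they lie in `k`, since
  -- the spinor image will be a preimage of a subgroup.
  refine ⟨Units.map (Matrix.detMonoidHom.comp
    ((e.toAlgHom.restrictScalars k).comp Algebra.TensorProduct.includeRight :
      A →ₐ[k] Matrix (Fin n) (Fin n) (AlgebraicClosure k)).toMonoidHom), fun a r ↦ ?_⟩
  rw [Units.ext_iff]
  constructor
  · rintro ⟨m, e', h⟩
    refine Eq.trans ?_ h
    -- Two splittings differ by an isomorphism of matrix algebras, which preserves determinants.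
    have := Matrix.det_map (e'.symm.trans e) (e' (1 ⊗ₜ[k] (a : A)))
    rw [AlgEquiv.trans_apply, AlgEquiv.symm_apply_apply] at this
    exact this
  · intro h
    exact ⟨n, e, h⟩

end Splitting

/-! ### Invariant flags over a division ring, their dimensions and weights -/

section Flags

variable {F : Type*} [DivisionRing F]

section Chains

variable {V : Type*} [AddCommGroup V] [Module F V] [FiniteDimensional F V]

/-- In a finite-dimensional space, a sublattice of subspaces (given by the predicate `P`) has
a maximal chain. -/
theorem exists_maximal_chain (P : Submodule F V → Prop) (hbot : P ⊥) (htop : P ⊤) :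
    ∃ W : ℕ → Submodule F V, Monotone W ∧ W 0 = ⊥ ∧ (∃ n, W n = ⊤) ∧ (∀ n, P (W n)) ∧
      ∀ n U, P U → W n ≤ U → U ≤ W (n + 1) → U = W n ∨ U = W (n + 1) := by
  have hstep : ∀ W : {W // P W}, ∃ W' : {W // P W}, W.1 ≤ W'.1 ∧ (W.1 ≠ ⊤ → W.1 < W'.1) ∧
      ∀ U, P U → W.1 ≤ U → U ≤ W'.1 → U = W.1 ∨ U = W'.1 := by
    rintro ⟨W, hW⟩
    by_cases h : W = ⊤
    · exact ⟨⟨W, hW⟩, le_rfl, fun h' ↦ (h' h).elim, fun U _ h1 h2 ↦ .inl (le_antisymm h2 h1)⟩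
    -- Below `⊤` the next member is a minimal strictly larger one; at `⊤` the chain is stationary,
    -- which allows indexing by `ℕ`.
    · obtain ⟨W', ⟨hW', hlt⟩, hmin⟩ := (wellFounded_lt (α := Submodule F V)).has_min
        {U | P U ∧ W < U} ⟨⊤, htop, lt_top_iff_ne_top.2 h⟩
      refine ⟨⟨W', hW'⟩, hlt.le, fun _ ↦ hlt, fun U hU h1 h2 ↦ ?_⟩
      rcases h1.eq_or_lt with h1 | h1
      · exact .inl h1.symm
      · rcases h2.eq_or_lt with h2 | h2
        · exact .inr h2
        · exact (hmin U ⟨hU, h1⟩ h2).elim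
  choose next h1 h2 h3 using hstep
  let S : ℕ → {W // P W} := fun n ↦ next^[n] ⟨⊥, hbot⟩
  have hS : ∀ n, S (n + 1) = next (S n) := fun n ↦ Function.iterate_succ_apply' next n _
  refine ⟨fun n ↦ (S n).1, monotone_nat_of_le_succ fun n ↦ ?_, rfl, ?_, fun n ↦ (S n).2,
    fun n U hU hl hr ↦ ?_⟩
  · rw [hS]
    exact h1 _
  · by_contra! hne
    have hsm : StrictMono fun n ↦ (S n).1 := strictMono_nat_of_lt_succ fun n ↦ by
      rw [hS]
      exact h2 _ (hne n)
    have hfr : StrictMono fun n ↦ Module.finrank F (S n).1 :=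
      fun a b hab ↦ Submodule.finrank_lt_finrank_of_lt (hsm hab)
    have := hfr.le_apply (x := Module.finrank F V + 1)
    have h' := Submodule.finrank_le (S (Module.finrank F V + 1)).1
    omega
  · change U ≤ (S (n + 1)).1 at hr
    change U = (S n).1 ∨ U = (S (n + 1)).1
    rw [hS] at hr ⊢
    exact h3 _ U hU hl hr

/-- The dimensions of the members of a sublattice of subspaces lie in the group which the
dimensions of the members of a maximal chain generate. -/
theorem finrank_mem_closure_of_maximal_chain (P : Submodule F V → Prop)
    (hinf : ∀ U U', P U → P U' → P (U ⊓ U')) (hsup : ∀ U U', P U → P U' → P (U ⊔ U'))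
    {W : ℕ → Submodule F V} (hmono : Monotone W) (h0 : W 0 = ⊥) (htop : ∃ n, W n = ⊤)
    (hP : ∀ n, P (W n))
    (hW : ∀ n U, P U → W n ≤ U → U ≤ W (n + 1) → U = W n ∨ U = W (n + 1))
    {U : Submodule F V} (hU : P U) :
    (Module.finrank F U : ℤ) ∈
      AddSubgroup.closure (Set.range fun n ↦ (Module.finrank F (W n) : ℤ)) := by
  have key : ∀ n, (Module.finrank F (U ⊓ W n : Submodule F V) : ℤ) ∈
      AddSubgroup.closure (Set.range fun n ↦ (Module.finrank F (W n) : ℤ)) := by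
    intro n
    induction n with
    | zero =>
      rw [h0, inf_bot_eq, finrank_bot]
      exact zero_mem _
    | succ n ih =>
      have hle := hmono n.le_succ
      -- By maximality of the chain, `U ⊓ W (n + 1)` either adds nothing to `U ⊓ W n` or fills the
      -- whole step. So the dimension jumps by `0` or by the full difference of two members of the
      -- chain.
      rcases hW n ((U ⊓ W (n + 1)) ⊔ W n) (hsup _ _ (hinf _ _ hU (hP _)) (hP _)) le_sup_right
        (sup_le inf_le_right hle) with h | h
      · have : U ⊓ W (n + 1) = U ⊓ W n := le_antisymm
          (le_inf inf_le_left (le_sup_left.trans h.le)) (inf_le_inf_left _ hle)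
        rw [this]
        exact ih
      · have := Submodule.finrank_sup_add_finrank_inf_eq (U ⊓ W (n + 1)) (W n)
        rw [h, inf_assoc, inf_eq_right.2 hle] at this
        have h' : (Module.finrank F (U ⊓ W (n + 1) : Submodule F V) : ℤ) =
            Module.finrank F (W (n + 1)) + Module.finrank F (U ⊓ W n : Submodule F V)
              - Module.finrank F (W n) := by omega
        rw [h']
        exact sub_mem (add_mem (AddSubgroup.subset_closure ⟨n + 1, rfl⟩) ih)
          (AddSubgroup.subset_closure ⟨n, rfl⟩)
  obtain ⟨n, hn⟩ := htop
  have := key n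
  rwa [hn, inf_top_eq] at this

/-- A basis which is adapted to a chain of subspaces. -/
theorem exists_basis_adapted {ι : Type*} [Fintype ι] (hι : Fintype.card ι = Module.finrank F V)
    {W : ℕ → Submodule F V} (hmono : Monotone W) (h0 : W 0 = ⊥) (htop : ∃ n, W n = ⊤) :
    ∃ (b : Module.Basis ι F V) (p : ι → ℕ),
      ∀ n, W n = Submodule.span F (b '' {i | p i < n}) := by
  classical
  have hstep : ∀ n (s : Set V), LinearIndepOn F id s → Submodule.span F s = W n →
      ∃ t : Set V, s ⊆ t ∧ LinearIndepOn F id t ∧ Submodule.span F t = W (n + 1) := by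
    intro n s hs hsW
    obtain ⟨t, ht, hst, hspan, hli⟩ := exists_linearIndepOn_extension (t := (W (n + 1) : Set V)) hs
      (Submodule.subset_span.trans (hsW.le.trans (hmono n.le_succ)))
    rw [Set.image_id, Set.image_id] at hspan
    exact ⟨t, hst, hli, le_antisymm (Submodule.span_le.2 ht) hspan⟩
  choose! next hsub hli hspan using hstep
  obtain ⟨S, hS0, hS1⟩ : ∃ S : ℕ → Set V, S 0 = ∅ ∧ ∀ n, S (n + 1) = next n (S n) :=
    ⟨fun n ↦ Nat.rec ∅ next n, rfl, fun _ ↦ rfl⟩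
  have hS : ∀ n, LinearIndepOn F id (S n) ∧ Submodule.span F (S n) = W n := by
    intro n
    induction n with
    | zero => exact hS0 ▸ ⟨linearIndepOn_empty _ _, by rw [h0]; exact Submodule.span_empty⟩
    | succ n ih => exact hS1 n ▸ ⟨hli n _ ih.1 ih.2, hspan n _ ih.1 ih.2⟩
  have hSmono : Monotone S := monotone_nat_of_le_succ fun n ↦
    hS1 n ▸ hsub n _ (hS n).1 (hS n).2
  obtain ⟨m, hm⟩ := htop
  have hli' : LinearIndependent F (fun v : ↥(S m) ↦ (v : V)) := (hS m).1
  let b₀ : Module.Basis ↥(S m) F V := Module.Basis.mk hli' (by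
    rw [Subtype.range_coe, (hS m).2, hm])
  have hb₀ : ∀ v : ↥(S m), b₀ v = v := fun v ↦ Module.Basis.mk_apply _ _ v
  have hfin : Fintype (S m) := 
    Fintype.ofEquiv _ ((Module.Free.chooseBasis F V).indexEquiv b₀)
  have hcard : Fintype.card (S m) = Fintype.card ι := by
    rw [hι, Module.finrank_eq_card_basis b₀]
  let σ : S m ≃ ι := Fintype.equivOfCardEq hcard
  have hex : ∀ v : V, v ∈ S m → ∃ n, v ∈ S (n + 1) := fun v hv ↦ ⟨m, hSmono m.le_succ hv⟩
  -- Since `S 0` is empty, `p i` is the last index at which the vector is still absent. This makes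
  -- `p i < n` equivalent to membership in `S n`.
  let p : ι → ℕ := fun i ↦ Nat.find (hex _ (σ.symm i).2)
  have hp : ∀ i n, p i < n ↔ ((σ.symm i : S m) : V) ∈ S n := by
    intro i n
    rw [Nat.find_lt_iff]
    constructor
    · rintro ⟨l, hl, h⟩
      exact hSmono hl h
    · intro h
      obtain _ | n := n
      · exact absurd (hS0 ▸ h) (Set.notMem_empty _)
      · exact ⟨n, n.lt_succ_self, h⟩
  refine ⟨b₀.reindex σ, p, fun n ↦ le_antisymm ?_ ?_⟩
  · rcases le_total n m with hnm | hnm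
    · rw [← (hS n).2]
      refine Submodule.span_mono fun v hv ↦ ⟨σ ⟨v, hSmono hnm hv⟩, ?_, ?_⟩
      · change p _ < n
        rw [hp]
        simpa using hv
      · simp [hb₀]
    · have : {i | p i < n} = Set.univ := Set.eq_univ_of_forall fun i ↦ by
        change p i < n
        rw [hp]
        exact hSmono hnm (σ.symm i).2
      rw [this, Set.image_univ, Module.Basis.span_eq]
      exact le_top
  · rw [Submodule.span_le]
    rintro _ ⟨i, hi, rfl⟩
    rw [← (hS n).2]
    refine Submodule.subset_span ?_
    have := (hp i n).1 hi
    simpa [hb₀] using this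

end Chains

/-- If the cardinalities of all initial pieces of `q` lie in a group, so does the sum of `q`. -/
theorem sum_mem_of_card_mem {ι : Type*} [Fintype ι] (Γ : AddSubgroup ℤ) (q : ι → ℤ)
    (h : ∀ c : ℤ, ((Finset.univ.filter fun j ↦ q j ≤ c).card : ℤ) ∈ Γ) : ∑ i, q i ∈ Γ := by
  classical
  obtain ⟨M, hM⟩ : ∃ M, ∀ j, q j ≤ M := by
    obtain ⟨M, hM⟩ := (Set.finite_range q).bddAbove
    exact ⟨M, fun j ↦ hM ⟨j, rfl⟩⟩
  obtain ⟨m, hm⟩ : ∃ m, ∀ j, m ≤ q j := by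
    obtain ⟨m, hm⟩ := (Set.finite_range q).bddBelow
    exact ⟨m, fun j ↦ hm ⟨j, rfl⟩⟩
  -- Layer-cake summation: exchanging the sums over `j` and `c` leaves only cardinalities of initial
  -- pieces.
  have h1 : ∀ j, M - q j = ∑ c ∈ Finset.Ico m M, if q j ≤ c then (1 : ℤ) else 0 := by
    intro j
    rw [← Finset.sum_filter, Finset.sum_const]
    have : Finset.filter (fun c ↦ q j ≤ c) (Finset.Ico m M) = Finset.Ico (q j) M := by
      ext c
      have := hm j
      simp only [Finset.mem_filter, Finset.mem_Ico]
      omega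
    rw [this, Int.card_Ico]
    have := hM j
    simp only [nsmul_eq_mul, mul_one]
    omega
  have h2 : ∑ i, q i = Fintype.card ι * M - ∑ i, (M - q i) := by
    rw [Finset.sum_sub_distrib]
    simp
  rw [h2, Finset.sum_congr rfl fun i _ ↦ h1 i, Finset.sum_comm]
  refine sub_mem ?_ (sum_mem fun c _ ↦ ?_)
  · have := h M
    rw [Finset.filter_true_of_mem fun j _ ↦ hM j, Finset.card_univ] at this
    rw [mul_comm]
    exact Γ.zsmul_mem this M
  · rw [← Finset.sum_filter, Finset.sum_const, nsmul_eq_mul, mul_one]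
    exact h c

/-- Every member of the group generated by the dimensions of a flag is a sum of monotone weights,
of bounded oscillation. -/
theorem exists_monotone_weights {ι : Type*} [Fintype ι] [Nonempty ι] (p : ι → ℕ) :
    ∃ N : ℕ, ∀ t ∈ AddSubgroup.closure
        (Set.range fun n ↦ ((Finset.univ.filter fun j ↦ p j < n).card : ℤ)),
      ∃ e : ι → ℤ, ∑ i, e i = t ∧ (∀ i j, p i ≤ p j → e i ≤ e j) ∧ ∀ i j, e i ≤ e j + N := by
  classical
  let f : ℤ := Fintype.card ι
  have hf : 0 < f := by
    have : 0 < Fintype.card ι := Fintype.card_pos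
    omega
  -- Monotone weights are closed under addition but not negation. Constant weights put `f ℤ` in `X`,
  -- and `-s = (f - 1) s + f (-s)` then makes `X` a group.
  let X : Set ℤ := {t | ∃ e : ι → ℤ, ∑ i, e i = t ∧ ∀ i j, p i ≤ p j → e i ≤ e j}
  have hadd : ∀ s ∈ X, ∀ t ∈ X, s + t ∈ X := by
    rintro _ ⟨e, rfl, he⟩ _ ⟨e', rfl, he'⟩
    exact ⟨e + e', Finset.sum_add_distrib, fun i j h ↦ add_le_add (he i j h) (he' i j h)⟩
  have hmul : ∀ m : ℤ, f * m ∈ X := fun m ↦ ⟨fun _ ↦ m, by simp [f], fun _ _ _ ↦ le_rfl⟩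
  have hnsmul : ∀ (n : ℕ), ∀ s ∈ X, n * s ∈ X := by
    intro n s hs
    induction n with
    | zero => simpa using hmul 0
    | succ n ih =>
      have := hadd _ ih _ hs
      rwa [Nat.cast_succ, add_mul, one_mul]
  have hneg : ∀ s ∈ X, -s ∈ X := by
    intro s hs
    have h1 := hadd _ (hnsmul (f - 1).toNat s hs) _ (hmul (-s))
    have h2 : (((f - 1).toNat : ℕ) : ℤ) = f - 1 := by omega
    rw [h2] at h1
    convert h1 using 1
    ring
  have hgen : ∀ n : ℕ, ((Finset.univ.filter fun j ↦ p j < n).card : ℤ) ∈ X := by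
    intro n
    -- The indicator of an initial piece decreases along `p`; its negative is monotone.
    have h1 : -((Finset.univ.filter fun j ↦ p j < n).card : ℤ) ∈ X := by
      refine ⟨fun i ↦ if p i < n then -1 else 0, ?_, fun i j h ↦ ?_⟩
      · rw [← Finset.sum_filter]
        simp
      · dsimp only
        split_ifs <;> omega
    simpa using hneg _ h1
  have hX : ∀ t ∈ AddSubgroup.closure
      (Set.range fun n ↦ ((Finset.univ.filter fun j ↦ p j < n).card : ℤ)), t ∈ X := by
    intro t ht
    induction ht using AddSubgroup.closure_induction with
    | mem t ht =>
      obtain ⟨n, rfl⟩ := ht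
      exact hgen n
    | zero => simpa using hmul 0
    | add s t _ _ hs ht => exact hadd s hs t ht
    | neg s _ hs => exact hneg s hs
  have hosc : ∀ t : ℤ, ∃ N : ℕ, t ∈ X → ∃ e : ι → ℤ, ∑ i, e i = t ∧
      (∀ i j, p i ≤ p j → e i ≤ e j) ∧ ∀ i j, e i ≤ e j + N := by
    intro t
    by_cases ht : t ∈ X
    · obtain ⟨e, he, hm⟩ := ht
      obtain ⟨a, ha⟩ := Finite.exists_max e
      obtain ⟨b, hb⟩ := Finite.exists_min e
      refine ⟨(e a - e b).toNat, fun _ ↦ ⟨e, he, hm, fun i j ↦ ?_⟩⟩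
      have := ha i
      have := hb j
      omega
    · exact ⟨0, fun h ↦ (ht h).elim⟩
  choose N hN using hosc
  -- Adding a constant to the weights changes their sum by a multiple of `f` and keeps the
  -- oscillation. So it is enough to treat the finitely many residues mod `f`.
  refine ⟨(Finset.Ico 0 f).sup N, fun t ht ↦ ?_⟩
  have hr : t % f ∈ X := by
    have := hadd _ (hX t ht) _ (hmul (-(t / f)))
    rw [Int.emod_def]
    convert this using 1
    ring
  obtain ⟨e, he, hm, ho⟩ := hN (t % f) hr
  have hle : N (t % f) ≤ (Finset.Ico 0 f).sup N := Finset.le_sup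
    (Finset.mem_Ico.2 ⟨Int.emod_nonneg t hf.ne', Int.emod_lt_of_pos t hf⟩)
  refine ⟨fun i ↦ e i + t / f, ?_, fun i j h ↦ by simpa using hm i j h, fun i j ↦ ?_⟩
  · rw [Finset.sum_add_distrib, he]
    simp only [Finset.sum_const, Finset.card_univ, nsmul_eq_mul]
    exact Int.emod_add_mul_ediv t f
  · have := ho i j
    dsimp only
    omega

variable {ι : Type*} [Fintype ι] [DecidableEq ι]

theorem linearIndependent_rows (B : (Matrix ι ι F)ˣ) :
    LinearIndependent F fun i ↦ (B : Matrix ι ι F) i := by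
  rw [Fintype.linearIndependent_iff]
  intro g hg i
  have h1 : Matrix.vecMul g (B : Matrix ι ι F) = 0 := by
    rw [← hg]
    ext j
    simp [Matrix.vecMul, dotProduct]
  have h2 := congrArg (fun v ↦ Matrix.vecMul v ((B⁻¹ : (Matrix ι ι F)ˣ) : Matrix ι ι F)) h1
  simp only [Matrix.vecMul_vecMul, Units.mul_inv, Matrix.vecMul_one, Matrix.zero_vecMul] at h2
  rw [h2]
  rfl

/-- For every set of matrices over a division ring there is a basis in which all its members are
block triangular, such that the dimensions of the flag of this basis generate the same group as
the dimensions of all invariant subspaces. -/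
theorem exists_adapted_unit (S : Set (Matrix ι ι F)) :
    ∃ (C : (Matrix ι ι F)ˣ) (p : ι → ℕ),
      (∀ x ∈ S, ∀ i j, p i < p j → ((C : Matrix ι ι F) * x * (C⁻¹ : (Matrix ι ι F)ˣ)) i j = 0) ∧
      ∀ (B : (Matrix ι ι F)ˣ) (q : ι → ℤ),
        (∀ x ∈ S, ∀ i j, q i < q j →
          ((B : Matrix ι ι F) * x * (B⁻¹ : (Matrix ι ι F)ˣ)) i j = 0) →
        ∑ i, q i ∈ AddSubgroup.closure
          (Set.range fun n ↦ ((Finset.univ.filter fun j ↦ p j < n).card : ℤ)) := by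
  classical
  -- Matrices act on row vectors from the right, so that the scalars of the noncommutative `F` act
  -- from the left.
  let P : Submodule F (ι → F) → Prop := fun W ↦ ∀ x ∈ S, ∀ v ∈ W, Matrix.vecMul v x ∈ W
  have hinf : ∀ U U', P U → P U' → P (U ⊓ U') := fun U U' hU hU' x hx v hv ↦
    ⟨hU x hx v hv.1, hU' x hx v hv.2⟩
  have hsup : ∀ U U', P U → P U' → P (U ⊔ U') := by
    intro U U' hU hU' x hx v hv
    obtain ⟨u, hu, u', hu', rfl⟩ := Submodule.mem_sup.1 hv
    rw [Matrix.add_vecMul]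
    exact Submodule.add_mem_sup (hU x hx u hu) (hU' x hx u' hu')
  have hbot : P ⊥ := by
    intro x _ v hv
    rw [Submodule.mem_bot] at hv ⊢
    rw [hv, Matrix.zero_vecMul]
  obtain ⟨W, hmono, h0, htop, hPW, hmax⟩ := exists_maximal_chain P hbot fun _ _ _ _ ↦ trivial
  obtain ⟨b, p, hb⟩ := exists_basis_adapted (ι := ι) (Module.finrank_fintype_fun_eq_card F).symm
    hmono h0 htop
  let C₁ : Matrix ι ι F := Matrix.of fun i ↦ b i
  -- The rows of `C₁` are the basis and those of `C₂` the coordinates of the standard vectors, so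
  -- the two are mutually inverse.
  let C₂ : Matrix ι ι F := Matrix.of fun i ↦ b.repr (Pi.single i 1)
  have hrepr : ∀ (v : ι → F) j, ∑ l, v l * b.repr (Pi.single l 1) j = b.repr v j := by
    intro v j
    have hv : v = ∑ l, v l • (Pi.single l 1 : ι → F) := by
      ext i
      simp [Finset.sum_apply, Pi.single_apply]
    conv_rhs => rw [hv]
    rw [map_sum, Finsupp.finsetSum_apply]
    simp
  have h12 : C₁ * C₂ = 1 := by
    ext i j
    rw [Matrix.mul_apply]
    refine (hrepr (b i) j).trans ?_
    rw [b.repr_self, Matrix.one_apply, Finsupp.single_apply]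
  have h21 : C₂ * C₁ = 1 := by
    ext i j
    rw [Matrix.mul_apply]
    have := congrFun (b.sum_repr (Pi.single i 1 : ι → F)) j
    rw [Finset.sum_apply] at this
    simp only [Pi.smul_apply, smul_eq_mul] at this
    refine this.trans ?_
    rw [Matrix.one_apply, Pi.single_apply]
    simp only [eq_comm]
  let C : (Matrix ι ι F)ˣ := ⟨C₁, C₂, h12, h21⟩
  have hfr : ∀ n, Module.finrank F (W n) = (Finset.univ.filter fun j ↦ p j < n).card := by
    intro n
    have := finrank_span_finset_eq_card (R := F) (s := (Finset.univ.filter fun j ↦ p j < n).image b)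
      (by
        rw [Finset.coe_image]
        exact (b.linearIndependent.linearIndepOn _).id_image)
    rw [Finset.card_image_of_injective _ b.injective] at this
    rw [← this, hb n, Finset.coe_image, Finset.coe_filter_univ]
  refine ⟨C, p, fun x hx i j hij ↦ ?_, fun B q hB ↦ ?_⟩
  · have hmem : Matrix.vecMul (b i) x ∈ W (p i + 1) := by
      refine hPW _ x hx _ ?_
      rw [hb]
      exact Submodule.subset_span ⟨i, Nat.lt_succ_self _, rfl⟩
    rw [hb, Module.Basis.mem_span_image] at hmem
    have hzero : b.repr (Matrix.vecMul (b i) x) j = 0 := by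
      by_contra hne
      have : p j < p i + 1 := hmem (Finsupp.mem_support_iff.2 hne)
      omega
    rw [Matrix.mul_apply, ← hzero, ← hrepr]
    rfl
  · refine sum_mem_of_card_mem _ q fun c ↦ ?_
    -- Triangularity with respect to `q` says that the span of these rows is invariant. Its
    -- dimension counts the indices with `q i ≤ c`.
    let U : Submodule F (ι → F) := Submodule.span F
      ((fun i ↦ (B : Matrix ι ι F) i) '' {i | q i ≤ c})
    have hPU : P U := by
      intro x hx v hv
      induction hv using Submodule.span_induction with
      | mem v hv =>
        obtain ⟨i, hi, rfl⟩ := hv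
        have hrow : Matrix.vecMul ((B : Matrix ι ι F) i) x
            = ∑ j, ((B : Matrix ι ι F) * x * (B⁻¹ : (Matrix ι ι F)ˣ)) i j •
              (B : Matrix ι ι F) j := by
          have h1 : Matrix.vecMul ((B : Matrix ι ι F) i) x
              = ((B : Matrix ι ι F) * x * (B⁻¹ : (Matrix ι ι F)ˣ) * B) i := by
            rw [mul_assoc _ _ (B : Matrix ι ι F), Units.inv_mul, mul_one]
            rfl
          rw [h1]
          ext l
          rw [Matrix.mul_apply, Finset.sum_apply]
          rfl
        rw [hrow]
        refine Submodule.sum_mem _ fun j _ ↦ ?_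
        by_cases hj : q j ≤ c
        · exact Submodule.smul_mem _ _ (Submodule.subset_span ⟨j, hj, rfl⟩)
        · rw [hB x hx i j (lt_of_le_of_lt hi (not_le.1 hj)), zero_smul]
          exact Submodule.zero_mem _
      | zero =>
        rw [Matrix.zero_vecMul]
        exact Submodule.zero_mem _
      | add u v _ _ hu hv =>
        rw [Matrix.add_vecMul]
        exact Submodule.add_mem _ hu hv
      | smul a v _ hv =>
        rw [Matrix.smul_vecMul]
        exact Submodule.smul_mem _ a hv
    have hcard : Module.finrank F U = (Finset.univ.filter fun j ↦ q j ≤ c).card := by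
      have := finrank_span_finset_eq_card (R := F)
        (s := (Finset.univ.filter fun j ↦ q j ≤ c).image fun i ↦ (B : Matrix ι ι F) i) (by
          rw [Finset.coe_image]
          exact ((linearIndependent_rows B).linearIndepOn _).id_image)
      rw [Finset.card_image_of_injective _ (linearIndependent_rows B).injective] at this
      rw [← this, Finset.coe_image, Finset.coe_filter_univ]
    rw [← hcard]
    have := finrank_mem_closure_of_maximal_chain P hinf hsup hmono h0 htop hPW hmax hPU
    simpa only [hfr] using this

end Flags

/-! ### Elementary divisors over a valued division ring -/

section Smith

theorem valuation_mul_matrix_le {E : Type*} [DivisionRing E] {ι : Type*} [Fintype ι] {Γ₀ : Type*}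
    [LinearOrderedCommGroupWithZero Γ₀] (w : Valuation E Γ₀) {M N : Matrix ι ι E} {a b : Γ₀} (hM : ∀ i j, w (M i j) ≤ a)
    (hN : ∀ i j, w (N i j) ≤ b) (i j : ι) : w ((M * N) i j) ≤ a * b := by
  rw [Matrix.mul_apply]
  refine w.map_sum_le fun l _ ↦ ?_
  rw [map_mul]
  exact mul_le_mul' (hM i l) (hN l j)

variable {E : Type*} [DivisionRing E] {ι : Type*} [Fintype ι] [DecidableEq ι]

/-- The matrix which permutes the coordinates by `σ`, as a unit. -/
def permUnit (E : Type*) [DivisionRing E] (σ : Equiv.Perm ι) : (Matrix ι ι E)ˣ where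
  val := Matrix.of fun i j ↦ if σ i = j then 1 else 0
  inv := Matrix.of fun i j ↦ if σ j = i then 1 else 0
  val_inv := by
    ext i j
    simp [Matrix.mul_apply, Matrix.one_apply, eq_comm]
  inv_val := by
    ext i j
    rw [Matrix.mul_apply, Matrix.one_apply, ← Equiv.sum_comp σ.symm]
    simp [eq_comm]

theorem permUnit_mul_apply (σ : Equiv.Perm ι) (M : Matrix ι ι E) (i j : ι) :
    ((permUnit E σ : Matrix ι ι E) * M) i j = M (σ i) j := by
  simp [permUnit, Matrix.mul_apply]

theorem mul_permUnit_inv_apply (σ : Equiv.Perm ι) (M : Matrix ι ι E) (i j : ι) :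
    (M * ((permUnit E σ)⁻¹ : (Matrix ι ι E)ˣ)) i j = M i (σ j) := by
  simp [permUnit, Units.inv_mk, Matrix.mul_apply]

/-- The unit `1 - u vᵀ` for vectors with `vᵀ u = 0`. -/
def transvectionUnit (u v : ι → E) (h : v ⬝ᵥ u = 0) : (Matrix ι ι E)ˣ where
  val := 1 - Matrix.vecMulVec u v
  inv := 1 + Matrix.vecMulVec u v
  val_inv := by
    have : Matrix.vecMulVec u v * Matrix.vecMulVec u v = 0 := by
      rw [Matrix.vecMulVec_mul_vecMulVec, h, zero_smul, Matrix.vecMulVec_zero]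
    rw [sub_mul, mul_add, mul_add, this]
    simp
  inv_val := by
    have : Matrix.vecMulVec u v * Matrix.vecMulVec u v = 0 := by
      rw [Matrix.vecMulVec_mul_vecMulVec, h, zero_smul, Matrix.vecMulVec_zero]
    rw [add_mul, mul_sub, mul_sub, this]
    simp

variable {Γ₀ : Type*} [LinearOrderedCommGroupWithZero Γ₀] (w : Valuation E Γ₀)

variable (ι) in
/-- The group of invertible matrices over the valuation ring of `w`. -/
def integralGL : Subgroup (Matrix ι ι E)ˣ where
  carrier := {U | (∀ i j, w ((U : Matrix ι ι E) i j) ≤ 1) ∧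
    ∀ i j, w (((U⁻¹ : (Matrix ι ι E)ˣ) : Matrix ι ι E) i j) ≤ 1}
  one_mem' := by
    have h : ∀ i j : ι, w ((1 : Matrix ι ι E) i j) ≤ 1 := fun i j ↦ by
      rw [Matrix.one_apply]
      split_ifs <;> simp
    exact ⟨h, fun i j ↦ by rw [inv_one]; exact h i j⟩
  mul_mem' := by
    rintro U V ⟨hU, hU'⟩ ⟨hV, hV'⟩
    refine ⟨fun i j ↦ ?_, fun i j ↦ ?_⟩
    · simpa using valuation_mul_matrix_le w hU hV i j
    · rw [mul_inv_rev]
      simpa using valuation_mul_matrix_le w hV' hU' i j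
  inv_mem' := by
    rintro U ⟨hU, hU'⟩
    exact ⟨hU', by rwa [inv_inv]⟩

theorem permUnit_mem_integralGL (σ : Equiv.Perm ι) : permUnit E σ ∈ integralGL ι w := by
  refine ⟨fun i j ↦ ?_, fun i j ↦ ?_⟩
  · change w (if σ i = j then 1 else 0) ≤ 1
    split_ifs <;> simp
  · change w (if σ j = i then 1 else 0) ≤ 1
    split_ifs <;> simp

theorem transvectionUnit_mem_integralGL (u v : ι → E) (h : v ⬝ᵥ u = 0) (hu : ∀ i, w (u i) ≤ 1)
    (hv : ∀ i, w (v i) ≤ 1) : transvectionUnit u v h ∈ integralGL ι w := by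
  have h1 : ∀ i j : ι, w ((1 : Matrix ι ι E) i j) ≤ 1 := (integralGL ι w).one_mem.1
  have h2 : ∀ i j : ι, w (Matrix.vecMulVec u v i j) ≤ 1 := fun i j ↦ by
    rw [Matrix.vecMulVec_apply, map_mul]
    exact mul_le_one' (hu i) (hv j)
  refine ⟨fun i j ↦ ?_, fun i j ↦ ?_⟩
  · exact w.map_sub_le (h1 i j) (h2 i j)
  · exact w.map_add_le (h1 i j) (h2 i j)

/-- Matrices over a division ring with valuation become diagonal by multiplication by invertible
matrices over the valuation ring. -/
theorem exists_mul_mul_eq_diagonal (M : Matrix ι ι E) :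
    ∃ U ∈ integralGL ι w, ∃ V ∈ integralGL ι w, ∃ d : ι → E,
      (U : Matrix ι ι E) * M * (V : Matrix ι ι E) = Matrix.diagonal d := by
  -- Elimination by induction on the set `s` of indices whose rows and columns are already cleared
  -- off the diagonal.
  have key : ∀ s : Finset ι, ∃ U ∈ integralGL ι w, ∃ V ∈ integralGL ι w,
      ∀ i j, i ≠ j → (i ∈ s ∨ j ∈ s) → ((U : Matrix ι ι E) * M * (V : Matrix ι ι E)) i j = 0 := by
    intro s
    induction s using Finset.induction_on with
    | empty => exact ⟨1, one_mem _, 1, one_mem _, by simp⟩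
    | insert q s hq ih =>
      obtain ⟨U, hU, V, hV, hUV⟩ := ih
      -- The pivot has maximal valuation in the remaining block, so all multipliers needed to clear
      -- its row and column are integral. Swaps fixing `s` move it to `(q, q)`.
      obtain ⟨⟨a, b⟩, hab, hmax⟩ := Finset.exists_max_image (sᶜ ×ˢ sᶜ)
        (fun x ↦ w (((U : Matrix ι ι E) * M * (V : Matrix ι ι E)) x.1 x.2))
        ⟨(q, q), by simp [hq]⟩
      simp only [Finset.mem_product, Finset.mem_compl] at hab hmax
      have hsw : ∀ c, c ∉ s → ∀ i, Equiv.swap c q i ∈ s ↔ i ∈ s := by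
        intro c hc i
        rcases eq_or_ne i c with rfl | hic
        · simp [hq, hc]
        · by_cases hiq : i = q
          · subst hiq
            simp [hq, hc]
          · rw [Equiv.swap_apply_of_ne_of_ne hic hiq]
      obtain ⟨U₁, hU₁, V₁, hV₁, X, hX, hX0, hXmax⟩ : ∃ U₁ ∈ integralGL ι w,
          ∃ V₁ ∈ integralGL ι w, ∃ X, (U₁ : Matrix ι ι E) * M * (V₁ : Matrix ι ι E) = X ∧
          (∀ i j, i ≠ j → (i ∈ s ∨ j ∈ s) → X i j = 0) ∧
          ∀ i j, i ∉ s → j ∉ s → w (X i j) ≤ w (X q q) := by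
        have hent : ∀ i j, (((permUnit E (Equiv.swap a q) * U : (Matrix ι ι E)ˣ) : Matrix ι ι E) *
            M * ((V * (permUnit E (Equiv.swap b q))⁻¹ : (Matrix ι ι E)ˣ) : Matrix ι ι E)) i j
            = ((U : Matrix ι ι E) * M * (V : Matrix ι ι E)) (Equiv.swap a q i)
              (Equiv.swap b q j) := by
          intro i j
          have h : ((permUnit E (Equiv.swap a q) * U : (Matrix ι ι E)ˣ) : Matrix ι ι E) * M *
              ((V * (permUnit E (Equiv.swap b q))⁻¹ : (Matrix ι ι E)ˣ) : Matrix ι ι E) =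
              (permUnit E (Equiv.swap a q) : Matrix ι ι E) *
                ((U : Matrix ι ι E) * M * (V : Matrix ι ι E)) *
                ((permUnit E (Equiv.swap b q))⁻¹ : (Matrix ι ι E)ˣ) := by
            simp only [Units.val_mul, mul_assoc]
          rw [h, mul_permUnit_inv_apply, permUnit_mul_apply]
        refine ⟨permUnit E (Equiv.swap a q) * U, mul_mem (permUnit_mem_integralGL w _) hU,
          V * (permUnit E (Equiv.swap b q))⁻¹,
          mul_mem hV (inv_mem (permUnit_mem_integralGL w _)), _, rfl, ?_, ?_⟩
        · intro i j hij h
          rw [hent]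
          refine hUV _ _ ?_ (h.imp (hsw a hab.1 i).2 (hsw b hab.2 j).2)
          rintro heq
          have hi : i ∈ s ∧ j ∈ s := by
            have h1 := hsw a hab.1 i
            have h2 := hsw b hab.2 j
            rw [heq] at h1
            rcases h with h | h
            · exact ⟨h, h2.1 (h1.2 h)⟩
            · exact ⟨h1.1 (h2.2 h), h⟩
          have hfix : ∀ c, c ∉ s → ∀ i ∈ s, Equiv.swap c q i = i := fun c hc i hi ↦
            Equiv.swap_apply_of_ne_of_ne (fun h ↦ hc (h ▸ hi)) (fun h ↦ hq (h ▸ hi))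
          rw [hfix a hab.1 i hi.1, hfix b hab.2 j hi.2] at heq
          exact hij heq
        · intro i j hi hj
          rw [hent, hent, Equiv.swap_apply_right, Equiv.swap_apply_right]
          exact hmax (_, _) ⟨fun h ↦ hi ((hsw a hab.1 i).1 h), fun h ↦ hj ((hsw b hab.2 j).1 h)⟩
      by_cases hc : X q q = 0
      · refine ⟨U₁, hU₁, V₁, hV₁, fun i j hij h ↦ ?_⟩
        rw [hX]
        by_cases h' : i ∈ s ∨ j ∈ s
        · exact hX0 i j hij h'
        · push Not at h'
          have := hXmax i j h'.1 h'.2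
          rw [hc, map_zero, le_zero_iff, map_eq_zero] at this
          exact this
      · let e : ι → E := Pi.single q 1
        -- As `E` is noncommutative, row operations use multipliers with the pivot inverted on the
        -- right, column operations with it inverted on the left.
        let u : ι → E := fun i ↦ if i = q then 0 else X i q * (X q q)⁻¹
        let v : ι → E := fun j ↦ if j = q then 0 else (X q q)⁻¹ * X q j
        have heu : e ⬝ᵥ u = 0 := by simp [e, u]
        have hve : v ⬝ᵥ e = 0 := by simp [e, v]
        have hc' : w (X q q) ≠ 0 := by simpa using hc
        have he : ∀ i, w (e i) ≤ 1 := fun i ↦ by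
          by_cases h : i = q
          · subst h
            simp [e]
          · simp [e, h]
        have hu : ∀ i, w (u i) ≤ 1 := fun i ↦ by
          by_cases h : i = q
          · simp [u, h]
          · simp only [u, if_neg h]
            by_cases hi : i ∈ s
            · simp [hX0 i q h (.inl hi)]
            · rw [map_mul, map_inv₀]
              exact mul_inv_le_one_of_le₀ (hXmax i q hi hq) zero_le
        have hv : ∀ i, w (v i) ≤ 1 := fun i ↦ by
          by_cases h : i = q
          · simp [v, h]
          · simp only [v, if_neg h]
            by_cases hi : i ∈ s
            · simp [hX0 q i (Ne.symm h) (.inr hi)]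
            · rw [map_mul, map_inv₀]
              exact inv_mul_le_one_of_le₀ (hXmax q i hq hi) zero_le
        refine ⟨transvectionUnit u e heu * U₁,
          mul_mem (transvectionUnit_mem_integralGL w u e heu hu he) hU₁,
          V₁ * transvectionUnit e v hve,
          mul_mem hV₁ (transvectionUnit_mem_integralGL w e v hve he hv), fun i j hij h ↦ ?_⟩
        have hL : ∀ Y : Matrix ι ι E, ∀ i j,
            ((transvectionUnit u e heu : Matrix ι ι E) * Y) i j = Y i j - u i * Y q j := by
          intro Y i j
          change ((1 - Matrix.vecMulVec u e) * Y) i j = _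
          rw [sub_mul, one_mul, Matrix.vecMulVec_mul, Matrix.sub_apply, Matrix.vecMulVec_apply]
          simp [e]
        have hR : ∀ Y : Matrix ι ι E, ∀ i j,
            (Y * (transvectionUnit e v hve : Matrix ι ι E)) i j = Y i j - Y i q * v j := by
          intro Y i j
          change (Y * (1 - Matrix.vecMulVec e v)) i j = _
          rw [mul_sub, mul_one, Matrix.mul_vecMulVec, Matrix.sub_apply, Matrix.vecMulVec_apply]
          simp [e]
        have hXX : ((transvectionUnit u e heu * U₁ : (Matrix ι ι E)ˣ) : Matrix ι ι E) * M *
            ((V₁ * transvectionUnit e v hve : (Matrix ι ι E)ˣ) : Matrix ι ι E) =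
            (transvectionUnit u e heu : Matrix ι ι E) * X * (transvectionUnit e v hve) := by
          rw [← hX, Units.val_mul, Units.val_mul]
          simp only [mul_assoc]
        rw [hXX, hR, hL, hL]
        by_cases hi : i = q
        · subst hi
          simp [u, v, Ne.symm hij, hc]
        · have h1 : X i q - u i * X q q = 0 := by simp [u, hi, hc]
          rw [h1, zero_mul, sub_zero]
          by_cases hj : j = q
          · rw [hj]
            exact h1
          · simp only [Finset.mem_insert, hi, hj, false_or] at h
            rw [hX0 i j hij h, zero_sub, neg_eq_zero]
            rcases h with h | h
            · simp [u, hi, hX0 i q hi (.inl h)]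
            · rw [hX0 q j (Ne.symm hj) (.inr h), mul_zero]
  obtain ⟨U, hU, V, hV, h⟩ := key Finset.univ
  refine ⟨U, hU, V, hV, fun i ↦ ((U : Matrix ι ι E) * M * (V : Matrix ι ι E)) i i, ?_⟩
  ext i j
  by_cases hij : i = j
  · subst hij
    rw [Matrix.diagonal_apply_eq]
  · rw [Matrix.diagonal_apply_ne _ hij]
    exact h i j hij (.inl (Finset.mem_univ _))

variable (E ι) in
/-- Invertible diagonal matrices. -/
def diagonalUnits : (ι → Eˣ) →* (Matrix ι ι E)ˣ :=
  (Units.map (Matrix.diagonalRingHom ι E).toMonoidHom).comp MulEquiv.piUnits.symm.toMonoidHom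

theorem coe_diagonalUnits (d : ι → Eˣ) :
    (diagonalUnits E ι d : Matrix ι ι E) = Matrix.diagonal fun i ↦ (d i : E) := rfl

theorem coe_inv_diagonalUnits (d : ι → Eˣ) :
    (((diagonalUnits E ι d)⁻¹ : (Matrix ι ι E)ˣ) : Matrix ι ι E)
      = Matrix.diagonal fun i ↦ (((d i)⁻¹ : Eˣ) : E) := by
  rw [← map_inv, coe_diagonalUnits]
  rfl

theorem diagonalUnits_conj_apply (d : ι → Eˣ) (x : Matrix ι ι E) (i j : ι) :
    ((diagonalUnits E ι d : Matrix ι ι E) * x *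
      ((diagonalUnits E ι d)⁻¹ : (Matrix ι ι E)ˣ)) i j = d i * x i j * ((d j)⁻¹ : Eˣ) := by
  rw [coe_diagonalUnits, coe_inv_diagonalUnits, Matrix.mul_diagonal, Matrix.diagonal_mul]

theorem diagonalUnits_mem_integralGL {d : ι → Eˣ} (hd : ∀ i, w (d i) = 1) :
    diagonalUnits E ι d ∈ integralGL ι w := by
  have h : ∀ d : ι → Eˣ, (∀ i, w (d i) = 1) →
      ∀ i j, w ((diagonalUnits E ι d : Matrix ι ι E) i j) ≤ 1 := by
    intro d hd i j
    rw [coe_diagonalUnits, Matrix.diagonal_apply]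
    split_ifs
    · exact (hd i).le
    · simp
  refine ⟨h d hd, fun i j ↦ ?_⟩
  rw [← map_inv]
  refine h _ (fun i ↦ ?_) i j
  rw [Pi.inv_apply, Units.val_inv_eq_inv_val, map_inv₀, hd, inv_one]

/-- Elementary divisors: the double cosets of the invertible matrices over the valuation ring are
represented by diagonal matrices of powers of a uniformizer. -/
theorem exists_eq_mul_diagonalUnits_mul {π : Eˣ} (hπ : ∀ x : Eˣ, ∃ n : ℤ, w x = w π ^ n)
    (a : (Matrix ι ι E)ˣ) :
    ∃ U ∈ integralGL ι w, ∃ V ∈ integralGL ι w, ∃ e : ι → ℤ,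
      a = U * diagonalUnits E ι (fun i ↦ π ^ e i) * V := by
  obtain ⟨U, hU, V, hV, d, hd⟩ := exists_mul_mul_eq_diagonal w (a : Matrix ι ι E)
  have hd0 : ∀ i, d i ≠ 0 := by
    intro i hi
    have h : ((U * a * V : (Matrix ι ι E)ˣ) : Matrix ι ι E) *
      ((U * a * V : (Matrix ι ι E)ˣ)⁻¹ : (Matrix ι ι E)ˣ) = 1 := Units.mul_inv _
    rw [Units.val_mul, Units.val_mul, hd] at h
    have := congrFun (congrFun h i) i
    rw [Matrix.diagonal_mul, hi, zero_mul, Matrix.one_apply_eq] at this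
    exact zero_ne_one this
  choose e he using fun i ↦ hπ (Units.mk0 (d i) (hd0 i))
  -- The entries of the diagonal matrix differ from powers of `π` by elements of valuation `1`,
  -- which are absorbed in the left factor.
  let u : ι → Eˣ := fun i ↦ Units.mk0 (d i) (hd0 i) * (π ^ e i)⁻¹
  have hu : diagonalUnits E ι u ∈ integralGL ι w := by
    refine diagonalUnits_mem_integralGL w fun i ↦ ?_
    have hne : w (π : E) ≠ 0 := by simp
    rw [Units.val_mul, map_mul, he, Units.val_inv_eq_inv_val, map_inv₀, Units.val_zpow_eq_zpow_val,
      map_zpow₀]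
    exact mul_inv_cancel₀ (zpow_ne_zero _ hne)
  refine ⟨U⁻¹ * diagonalUnits E ι u, mul_mem (inv_mem hU) hu, V⁻¹, inv_mem hV, e, ?_⟩
  have h : U * a * V = diagonalUnits E ι u * diagonalUnits E ι (fun i ↦ π ^ e i) := by
    rw [← map_mul]
    refine Units.ext ?_
    rw [coe_diagonalUnits, Units.val_mul, Units.val_mul, hd]
    congr 1
    ext i
    simp [u]
  rw [mul_assoc U⁻¹, ← h]
  group

/-- A homomorphism from the general linear group to a commutative group depends only on the total
exponent of a diagonal matrix of powers of `π`. -/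
theorem map_diagonalUnits_zpow {G : Type*} [CommGroup G] (ν : (Matrix ι ι E)ˣ →* G) (π : Eˣ)
    (i₀ : ι) (e : ι → ℤ) :
    ν (diagonalUnits E ι fun i ↦ π ^ e i) =
      ν (diagonalUnits E ι (Pi.mulSingle i₀ π)) ^ ∑ i, e i := by
  have hsingle : ∀ i, ν (diagonalUnits E ι (Pi.mulSingle i π)) =
      ν (diagonalUnits E ι (Pi.mulSingle i₀ π)) := by
    intro i
    -- Moving `π` along the diagonal is conjugation by a permutation matrix, which is invisible in a
    -- commutative group.
    have h : permUnit E (Equiv.swap i i₀) * diagonalUnits E ι (Pi.mulSingle i₀ π) =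
        diagonalUnits E ι (Pi.mulSingle i π) * permUnit E (Equiv.swap i i₀) := by
      refine Units.ext ?_
      ext l m
      rw [Units.val_mul, Units.val_mul, permUnit_mul_apply, coe_diagonalUnits, coe_diagonalUnits,
        Matrix.diagonal_mul, Matrix.diagonal_apply]
      change _ = _ * (if Equiv.swap i i₀ l = m then 1 else 0)
      split_ifs with hlm
      · have hl : (Equiv.swap i i₀ l = i₀) = (l = i) := by
          rw [Equiv.swap_apply_eq_iff, Equiv.swap_apply_right]
        simp only [Pi.mulSingle_apply, hl, mul_one]
      · rw [mul_zero]
    have := congrArg ν h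
    rw [map_mul, map_mul, mul_comm] at this
    exact (mul_right_cancel this).symm
  have key : ∀ s : Finset ι, ν (diagonalUnits E ι fun i ↦ if i ∈ s then π ^ e i else 1) =
      ν (diagonalUnits E ι (Pi.mulSingle i₀ π)) ^ ∑ i ∈ s, e i := by
    intro s
    induction s using Finset.induction_on with
    | empty =>
      simp only [Finset.notMem_empty, if_false, Finset.sum_empty, zpow_zero]
      exact (congrArg ν (map_one _)).trans (map_one _)
    | insert q s hq ih =>
      have h : (fun i ↦ if i ∈ insert q s then π ^ e i else 1) =
          (Pi.mulSingle q π) ^ e q * fun i ↦ if i ∈ s then π ^ e i else 1 := by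
        ext i
        by_cases hi : i = q
        · subst hi
          simp [hq]
        · simp [hi]
      rw [h, map_mul, map_mul, map_zpow, map_zpow, hsingle, ih, Finset.sum_insert hq, zpow_add]
  simpa using key Finset.univ

end Smith

/-! ### Valuation of the division algebra and lifting of units from the residue ring -/

section DivisionAlgebra

variable {k : Type*} [Field k] [ValuativeRel k] [TopologicalSpace k]
  [IsNonarchimedeanLocalField k]
  {E : Type*} [DivisionRing E] [Algebra k E] [FiniteDimensional k E]

variable (k E) in
/-- The valuation of `E` which is given by the norm to `k`. -/
noncomputable def divisionValuation : Valuation E (ValueGroupWithZero k) where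
  toFun x := valuation k (Algebra.norm k x)
  map_zero' := by rw [Algebra.norm_zero, map_zero]
  map_one' := by rw [map_one, map_one]
  map_mul' x y := by rw [map_mul, map_mul]
  map_add_le_max' := valuation_norm_add_le

theorem divisionValuation_algebraMap (c : k) :
    divisionValuation k E (algebraMap k E c) = valuation k c ^ Module.finrank k E := by
  change valuation k (Algebra.norm k (algebraMap k E c)) = _
  rw [Algebra.norm_algebraMap, map_pow]

theorem divisionValuation_smul (c : k) (x : E) :
    divisionValuation k E (c • x)
      = valuation k c ^ Module.finrank k E * divisionValuation k E x := by
  rw [Algebra.smul_def, map_mul, divisionValuation_algebraMap]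

theorem mem_divisionIntegers_iff {x : E} :
    x ∈ divisionIntegers k E ↔ divisionValuation k E x ≤ 1 :=
  isIntegral_iff_valuation_norm_le_one

theorem divisionValuation_coe_le_one (x : divisionIntegers k E) :
    divisionValuation k E (x : E) ≤ 1 := mem_divisionIntegers_iff.1 x.2

theorem mk_eq_zero_iff {x : divisionIntegers k E} :
    Ideal.Quotient.mk (divisionMaximalIdeal k E) x = 0 ↔ divisionValuation k E (x : E) < 1 := by
  rw [Ideal.Quotient.eq_zero_iff_mem, mem_divisionMaximalIdeal, not_isUnit_divisionIntegers_iff]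
  rfl

variable (k E) in
-- The value group of `k` is cyclic, hence so is the group of values of the norm valuation. It is
-- nontrivial because on `k` the valuation is a positive power of that of `k`; so a generator or its
-- inverse has value below `1`.
theorem exists_uniformizer : ∃ π : Eˣ, divisionValuation k E π < 1 ∧
    ∀ x : Eˣ, ∃ n : ℤ, divisionValuation k E x = divisionValuation k E π ^ n := by
  let φ : Eˣ →* (ValueGroupWithZero k)ˣ := Units.map (divisionValuation k E : E →* _)
  obtain ⟨⟨_, ⟨g, rfl⟩⟩, hg⟩ := (Subgroup.isCyclic φ.range).exists_generator
  have hgen : ∀ x : Eˣ, ∃ n : ℤ, divisionValuation k E x = divisionValuation k E g ^ n := by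
    intro x
    obtain ⟨n, hn⟩ := Subgroup.mem_zpowers_iff.1 (hg ⟨_, ⟨x, rfl⟩⟩)
    have := congrArg (fun y : φ.range ↦ ((y : (ValueGroupWithZero k)ˣ) : ValueGroupWithZero k)) hn
    simp only [Subgroup.coe_zpow, Units.val_zpow_eq_zpow_val] at this
    exact ⟨n, this.symm⟩
  rcases lt_trichotomy (divisionValuation k E (g : E)) 1 with h | h | h
  · exact ⟨g, h, hgen⟩
  · exfalso
    obtain ⟨γ, h0, h1⟩ := ValuativeRel.IsNontrivial.condition (R := k)
    obtain ⟨c, rfl⟩ := ValuativeRel.valuation_surjective γ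
    have hc : c ≠ 0 := by
      rintro rfl
      simp at h0
    obtain ⟨n, hn⟩ := hgen (Units.map (algebraMap k E).toMonoidHom (Units.mk0 c hc))
    rw [h, one_zpow] at hn
    have hn' : divisionValuation k E (algebraMap k E c) = 1 := hn
    rw [divisionValuation_algebraMap] at hn'
    exact h1 ((pow_eq_one_iff_of_nonneg zero_le Module.finrank_pos.ne').1 hn')
  · refine ⟨g⁻¹, ?_, fun x ↦ ?_⟩
    · rw [Units.val_inv_eq_inv_val, map_inv₀]
      exact inv_lt_one_of_one_lt₀ h
    · obtain ⟨n, hn⟩ := hgen x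
      refine ⟨-n, ?_⟩
      rw [hn, Units.val_inv_eq_inv_val, map_inv₀, inv_zpow', neg_neg]

theorem residueAlgebra_isUnit_or_eq_zero (x : ResidueAlgebra k E) : IsUnit x ∨ x = 0 := by
  obtain ⟨y, rfl⟩ := Ideal.Quotient.mk_surjective x
  by_cases hy : IsUnit y
  · exact .inl (hy.map _)
  · exact .inr (Ideal.Quotient.eq_zero_iff_mem.2 hy)

instance : Nontrivial (ResidueAlgebra k E) :=
  ⟨1, 0, fun h ↦ by
    have h1 : Ideal.Quotient.mk (divisionMaximalIdeal k E) 1 = 0 := h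
    rw [Ideal.Quotient.eq_zero_iff_mem, mem_divisionMaximalIdeal] at h1
    exact h1 isUnit_one⟩

variable (k E) in
-- Integral elements have uniformly bounded coordinates, so `𝒪_E` lies in a finitely generated
-- module over the noetherian ring `𝒪[k]`.
theorem divisionIntegers_finite : Module.Finite 𝒪[k] (divisionIntegers k E) := by
  classical
  let b := Module.finBasis k E
  obtain ⟨C, hC, hb⟩ := exists_coord_bound k E b
  let P : Submodule 𝒪[k] E := Submodule.span 𝒪[k] (Set.range fun i ↦ C • b i)
  have hP : P.FG := Submodule.fg_span (Set.finite_range _)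
  have hle : Subalgebra.toSubmodule (divisionIntegers k E) ≤ P := by
    intro y hy
    rw [← b.sum_repr y]
    refine Submodule.sum_mem _ fun i _ ↦ ?_
    have hv : valuation k (C⁻¹ * b.repr y i) ≤ 1 := by
      rw [map_mul, map_inv₀]
      exact inv_mul_le_one_of_le₀ (hb y (mem_divisionIntegers_iff.1 hy) i) zero_le
    have : b.repr y i • b i = (⟨C⁻¹ * b.repr y i, hv⟩ : 𝒪[k]) • (C • b i) := by
      change _ = (C⁻¹ * b.repr y i) • (C • b i)
      rw [smul_smul]
      congr 1
      field_simp
    rw [this]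
    exact Submodule.smul_mem _ _ (Submodule.subset_span ⟨i, rfl⟩)
  have : IsNoetherian 𝒪[k] P := isNoetherian_of_fg_of_noetherian P hP
  exact Module.Finite.iff_fg.2 (isNoetherian_submodule.1 this _ hle)

variable {f : ℕ}

theorem matrixInclusion_apply (m : Matrix (Fin f) (Fin f) (divisionIntegers k E)) (i j : Fin f) :
    matrixInclusion k E f m i j = (m i j : E) := rfl

theorem matrixReduction_apply (m : Matrix (Fin f) (Fin f) (divisionIntegers k E)) (i j : Fin f) :
    matrixReduction k E f m i j = Ideal.Quotient.mk (divisionMaximalIdeal k E) (m i j) := rfl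

theorem matrixReduction_apply_eq_zero_iff
    {m : Matrix (Fin f) (Fin f) (divisionIntegers k E)} {i j : Fin f} :
    matrixReduction k E f m i j = 0 ↔ divisionValuation k E (matrixInclusion k E f m i j) < 1 :=
  mk_eq_zero_iff

theorem matrixInclusion_injective : Function.Injective (matrixInclusion k E f) := by
  intro m m' h
  ext i j
  exact congrFun (congrFun h i) j

theorem mem_matrixOrder_iff {x : Matrix (Fin f) (Fin f) E} :
    x ∈ matrixOrder k E f ↔ ∀ i j, divisionValuation k E (x i j) ≤ 1 := by
  constructor
  · rintro ⟨m, rfl⟩ i j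
    exact divisionValuation_coe_le_one (m i j)
  · intro h
    exact ⟨Matrix.of fun i j ↦ ⟨x i j, mem_divisionIntegers_iff.2 (h i j)⟩, rfl⟩

theorem exists_units_of_mem_integralGL {U : (Matrix (Fin f) (Fin f) E)ˣ}
    (hU : U ∈ integralGL (Fin f) (divisionValuation k E)) :
    ∃ u : (Matrix (Fin f) (Fin f) (divisionIntegers k E))ˣ,
      Units.map (matrixInclusion k E f).toMonoidHom u = U := by
  obtain ⟨u, hu⟩ := mem_matrixOrder_iff.2 hU.1
  obtain ⟨v, hv⟩ := mem_matrixOrder_iff.2 hU.2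
  refine ⟨⟨u, v, matrixInclusion_injective ?_, matrixInclusion_injective ?_⟩, Units.ext hu⟩
  · rw [map_mul, map_one, ← U.mul_inv]
    exact congrArg₂ _ hu hv
  · rw [map_mul, map_one, ← U.inv_mul]
    exact congrArg₂ _ hv hu

theorem units_map_matrixInclusion_mem (u : (Matrix (Fin f) (Fin f) (divisionIntegers k E))ˣ) :
    Units.map (matrixInclusion k E f).toMonoidHom u ∈
      integralGL (Fin f) (divisionValuation k E) :=
  ⟨fun _ _ ↦ divisionValuation_coe_le_one _, fun _ _ ↦ divisionValuation_coe_le_one _⟩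

variable (k E) in
-- The non-units form an ideal, so `1 + y * x` is a unit for `x` in it. This is what allows units to
-- be lifted from the residue ring.
theorem divisionMaximalIdeal_le_jacobson :
    divisionMaximalIdeal k E ≤ (⊥ : Ideal (divisionIntegers k E)).jacobson := by
  intro x hx
  rw [Ideal.mem_jacobson_iff]
  intro y
  have hu : IsUnit (1 + y * x) := by
    by_contra h
    have h1 : (1 : divisionIntegers k E) ∈ divisionMaximalIdeal k E := by
      have := sub_mem (mem_divisionMaximalIdeal.2 h) (Ideal.mul_mem_left _ y hx)
      rwa [add_sub_cancel_right] at this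
    exact h1 isUnit_one
  obtain ⟨u, hu⟩ := hu
  refine ⟨(u⁻¹ : (divisionIntegers k E)ˣ), ?_⟩
  have h : ((u⁻¹ : (divisionIntegers k E)ˣ) : divisionIntegers k E) * (1 + y * x) = 1 := by
    rw [← hu, Units.inv_mul]
  rw [Ideal.mem_bot, mul_assoc, sub_eq_zero, ← h, mul_add, mul_one, add_comm]

theorem matrixReduction_surjective : Function.Surjective (matrixReduction k E f) := by
  intro y
  choose c hc using fun i j ↦ Ideal.Quotient.mk_surjective (y i j)
  exact ⟨Matrix.of c, by ext i j; exact hc i j⟩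

/-- Invertible matrices over the residue ring lift to invertible matrices over the integers. -/
theorem exists_units_lift (C : (Matrix (Fin f) (Fin f) (ResidueAlgebra k E))ˣ) :
    ∃ c : (Matrix (Fin f) (Fin f) (divisionIntegers k E))ˣ,
      Units.map (matrixReduction k E f).toMonoidHom c = C := by
  obtain ⟨c, hc⟩ := matrixReduction_surjective (C : Matrix (Fin f) (Fin f) (ResidueAlgebra k E))
  obtain ⟨d, hd⟩ := matrixReduction_surjective
    ((C⁻¹ : (Matrix (Fin f) (Fin f) (ResidueAlgebra k E))ˣ) :
      Matrix (Fin f) (Fin f) (ResidueAlgebra k E))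
  -- For arbitrary lifts `c`, `d` of `C`, `C⁻¹`, the product `d * c` is `1` modulo the Jacobson
  -- radical, hence has a left inverse `z`.
  have hdc : d * c - 1 ∈
      (⊥ : Ideal (Matrix (Fin f) (Fin f) (divisionIntegers k E))).jacobson := by
    rw [← Ideal.matrix_bot]
    refine Ideal.matrix_jacobson_le _ fun i j ↦ divisionMaximalIdeal_le_jacobson k E ?_
    rw [← Ideal.Quotient.eq_zero_iff_mem, ← matrixReduction_apply, map_sub, map_mul, hc, hd,
      Units.inv_mul, map_one, sub_self]
    rfl
  obtain ⟨z, hz⟩ := Ideal.mem_jacobson_iff.1 hdc 1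
  rw [Ideal.mem_bot, mul_one, mul_sub, mul_one, sub_add_cancel, sub_eq_zero, ← mul_assoc] at hz
  -- One-sided inverses are two-sided in `M_f(E)`, and the inclusion of the integral matrices is
  -- injective.
  have hz' : c * (z * d) = 1 := by
    apply matrixInclusion_injective
    rw [map_mul, map_one]
    refine mul_eq_one_symm ?_
    rw [← map_mul, hz, map_one]
  exact ⟨⟨c, z * d, hz', hz⟩, Units.ext hc⟩

end DivisionAlgebra

/-! ### The order attached to a flag and its spinor image -/

section FlagOrder

/-- The form needed for `𝔼`: the division ring structure is introduced only inside the proof, on top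
of the given quotient ring structure. -/
theorem exists_adapted_unit_of_isUnit_or_eq_zero {F : Type*} [Ring F] [Nontrivial F]
    (hF : ∀ a : F, IsUnit a ∨ a = 0) {ι : Type*} [Fintype ι] [DecidableEq ι]
    (S : Set (Matrix ι ι F)) :
    ∃ (C : (Matrix ι ι F)ˣ) (p : ι → ℕ),
      (∀ x ∈ S, ∀ i j, p i < p j → ((C : Matrix ι ι F) * x * (C⁻¹ : (Matrix ι ι F)ˣ)) i j = 0) ∧
      ∀ (B : (Matrix ι ι F)ˣ) (q : ι → ℤ),
        (∀ x ∈ S, ∀ i j, q i < q j →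
          ((B : Matrix ι ι F) * x * (B⁻¹ : (Matrix ι ι F)ˣ)) i j = 0) →
        ∑ i, q i ∈ AddSubgroup.closure
          (Set.range fun n ↦ ((Finset.univ.filter fun j ↦ p j < n).card : ℤ)) := by
  let := DivisionRing.ofIsUnitOrEqZero hF
  exact exists_adapted_unit S

variable {k : Type*} [Field k] [ValuativeRel k] [TopologicalSpace k]
  [IsNonarchimedeanLocalField k]
  {E : Type*} [DivisionRing E] [Algebra k E] [FiniteDimensional k E] {f : ℕ}

/-- The integral matrices whose entries above the block diagonal given by `p` have valuation
at most `ε`. -/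
noncomputable def blockOrder (k : Type*) [Field k] [ValuativeRel k] [TopologicalSpace k]
    [IsNonarchimedeanLocalField k] (E : Type*) [DivisionRing E] [Algebra k E]
    [FiniteDimensional k E] {f : ℕ} (p : Fin f → ℕ) (ε : ValueGroupWithZero k) :
    Subalgebra 𝒪[k] (Matrix (Fin f) (Fin f) E) where
  carrier := {x | x ∈ matrixOrder k E f ∧ ∀ i j, p i < p j → divisionValuation k E (x i j) ≤ ε}
  mul_mem' := by
    rintro x y ⟨hx, hx'⟩ ⟨hy, hy'⟩
    refine ⟨mul_mem hx hy, fun i j hij ↦ ?_⟩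
    rw [Matrix.mul_apply]
    refine (divisionValuation k E).map_sum_le fun l _ ↦ ?_
    rw [map_mul]
    -- For `p i < p j` any intermediate `l` satisfies `p i < p l` or `p l < p j`, so one of the
    -- factors is small and the other integral.
    rcases lt_or_ge (p i) (p l) with h | h
    · exact (mul_le_of_le_one_right' (mem_matrixOrder_iff.1 hy l j)).trans (hx' i l h)
    · exact (mul_le_of_le_one_left' (mem_matrixOrder_iff.1 hx i l)).trans
        (hy' l j (h.trans_lt hij))
  add_mem' := by
    rintro x y ⟨hx, hx'⟩ ⟨hy, hy'⟩
    exact ⟨add_mem hx hy, fun i j hij ↦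
      (divisionValuation k E).map_add_le (hx' i j hij) (hy' i j hij)⟩
  algebraMap_mem' r := by
    refine ⟨Subalgebra.algebraMap_mem _ r, fun i j hij ↦ ?_⟩
    have hne : i ≠ j := fun h ↦ (h ▸ hij).ne rfl
    rw [Matrix.algebraMap_matrix_apply, if_neg hne, map_zero]
    exact zero_le

/-- The order of all integral matrices with reduction in `R`, whose conjugates by `C` are close to
block triangular matrices. -/
noncomputable def flagOrder
    (R : Subalgebra 𝒪[k] (Matrix (Fin f) (Fin f) (ResidueAlgebra k E)))
    (C : (Matrix (Fin f) (Fin f) E)ˣ) (p : Fin f → ℕ) (ε : ValueGroupWithZero k) :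
    Subalgebra 𝒪[k] (Matrix (Fin f) (Fin f) E) :=
  (R.comap (matrixReduction k E f)).map (matrixInclusion k E f) ⊓
    (blockOrder k E p ε).comap (MulSemiringAction.toAlgHom 𝒪[k] _ (ConjAct.toConjAct C))

variable {R : Subalgebra 𝒪[k] (Matrix (Fin f) (Fin f) (ResidueAlgebra k E))}
  {C : (Matrix (Fin f) (Fin f) E)ˣ} {p : Fin f → ℕ} {ε : ValueGroupWithZero k}

theorem mem_flagOrder_iff {x : Matrix (Fin f) (Fin f) E} :
    x ∈ flagOrder R C p ε ↔
      (∃ m, matrixReduction k E f m ∈ R ∧ matrixInclusion k E f m = x) ∧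
        (C : Matrix (Fin f) (Fin f) E) * x * (C⁻¹ : (Matrix (Fin f) (Fin f) E)ˣ) ∈
          blockOrder k E p ε := Iff.rfl

theorem conj_mem_matrixOrder {U : (Matrix (Fin f) (Fin f) E)ˣ}
    (hU : U ∈ integralGL (Fin f) (divisionValuation k E)) {x : Matrix (Fin f) (Fin f) E}
    (hx : x ∈ matrixOrder k E f) :
    (U : Matrix (Fin f) (Fin f) E) * x * (U⁻¹ : (Matrix (Fin f) (Fin f) E)ˣ) ∈
      matrixOrder k E f :=
  mul_mem (mul_mem (mem_matrixOrder_iff.2 hU.1) hx) (mem_matrixOrder_iff.2 hU.2)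

theorem flagOrder_le : flagOrder R C p ε ≤ matrixOrder k E f := by
  rintro x ⟨⟨m, -, rfl⟩, -⟩
  exact ⟨m, rfl⟩

theorem mem_residualImage_iff {H : Subalgebra 𝒪[k] (Matrix (Fin f) (Fin f) E)}
    {y : Matrix (Fin f) (Fin f) (ResidueAlgebra k E)} :
    y ∈ residualImage H ↔ ∃ m, matrixInclusion k E f m ∈ H ∧ matrixReduction k E f m = y := Iff.rfl

/-- In the basis given by `c` the members of `R` are exactly block triangular. They therefore lift
with zeros above the blocks, which meets the condition for every `ε`. -/
theorem residualImage_flagOrder {c : (Matrix (Fin f) (Fin f) (divisionIntegers k E))ˣ}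
    (hc : ∀ x ∈ R, ∀ i j, p i < p j →
      ((Units.map (matrixReduction k E f).toMonoidHom c :
          Matrix (Fin f) (Fin f) (ResidueAlgebra k E)) * x *
        ((Units.map (matrixReduction k E f).toMonoidHom c)⁻¹ :
          (Matrix (Fin f) (Fin f) (ResidueAlgebra k E))ˣ)) i j = 0) :
    residualImage (flagOrder R (Units.map (matrixInclusion k E f).toMonoidHom c) p ε) = R := by
  classical
  apply le_antisymm
  · intro y hy
    obtain ⟨m, hm, rfl⟩ := mem_residualImage_iff.1 hy
    obtain ⟨⟨m', hm', h⟩, -⟩ := mem_flagOrder_iff.1 hm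
    rwa [← matrixInclusion_injective h]
  · intro x hx
    rw [mem_residualImage_iff]
    obtain ⟨z₀, hz₀⟩ := matrixReduction_surjective
      (matrixReduction k E f c * x * matrixReduction k E f (c⁻¹ : (Matrix (Fin f) (Fin f) (divisionIntegers k E))ˣ))
    let z : Matrix (Fin f) (Fin f) (divisionIntegers k E) :=
      Matrix.of fun i j ↦ if p i < p j then 0 else z₀ i j
    have hz : matrixReduction k E f z =
        matrixReduction k E f c * x * matrixReduction k E f (c⁻¹ : (Matrix (Fin f) (Fin f) (divisionIntegers k E))ˣ) := by
      rw [← hz₀]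
      ext i j
      by_cases hij : p i < p j
      · have : matrixReduction k E f z₀ i j = 0 := by
          rw [hz₀]
          exact hc x hx i j hij
        rw [this, matrixReduction_apply]
        simp [z, hij]
      · rw [matrixReduction_apply, matrixReduction_apply]
        simp [z, hij]
    have hcc : matrixReduction k E f (c⁻¹ : (Matrix (Fin f) (Fin f) (divisionIntegers k E))ˣ) * matrixReduction k E f c = 1 := by
      rw [← map_mul, Units.inv_mul, map_one]
    have hred : matrixReduction k E f ((c⁻¹ : (Matrix (Fin f) (Fin f) (divisionIntegers k E))ˣ) * z * c) = x := by
      rw [map_mul, map_mul, hz]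
      simp only [mul_assoc, hcc, mul_one]
      rw [← mul_assoc, hcc, one_mul]
    refine ⟨(c⁻¹ : (Matrix (Fin f) (Fin f) (divisionIntegers k E))ˣ) * z * c, mem_flagOrder_iff.2 ⟨⟨_, ?_, rfl⟩, ?_⟩, hred⟩
    · rw [hred]
      exact hx
    · have : (Units.map (matrixInclusion k E f).toMonoidHom c : Matrix (Fin f) (Fin f) E) *
          matrixInclusion k E f ((c⁻¹ : (Matrix (Fin f) (Fin f) (divisionIntegers k E))ˣ) * z * c) *
          ((Units.map (matrixInclusion k E f).toMonoidHom c)⁻¹ : (Matrix _ _ _)ˣ) =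
          matrixInclusion k E f z := by
        rw [← map_inv]
        change matrixInclusion k E f c * _ * matrixInclusion k E f (c⁻¹ : (Matrix (Fin f) (Fin f) (divisionIntegers k E))ˣ) = _
        rw [← map_mul, ← map_mul]
        congr 1
        simp [mul_assoc]
      rw [this]
      refine ⟨⟨z, rfl⟩, fun i j hij ↦ ?_⟩
      rw [matrixInclusion_apply]
      simp [z, hij]

/-- The order is a submodule of the noetherian module `M_f(𝒪_E)`. It spans because a small enough
multiple of any matrix reduces to zero and stays small under conjugation by `C`. -/
theorem isLocalOrder_flagOrder (hC : C ∈ integralGL (Fin f) (divisionValuation k E))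
    (hε : ε ≠ 0) : IsLocalOrder (flagOrder R C p ε) where
  fg := by
    have := divisionIntegers_finite k E
    have hfg : (Subalgebra.toSubmodule (matrixOrder k E f)).FG :=
      Module.Finite.iff_fg.1 (Module.Finite.range (matrixInclusion k E f).toLinearMap)
    have : IsNoetherian 𝒪[k] (Subalgebra.toSubmodule (matrixOrder k E f)) :=
      isNoetherian_of_fg_of_noetherian _ hfg
    exact isNoetherian_submodule.1 this _ flagOrder_le
  span_eq_top := by
    rw [eq_top_iff]
    rintro x -
    obtain ⟨π, hπ, -⟩ := exists_uniformizer k E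
    have hπ0 : divisionValuation k E (π : E) ≠ 0 := by simp
    obtain ⟨B, hB1, hB⟩ : ∃ B : ValueGroupWithZero k, 1 ≤ B ∧
        ∀ i j, divisionValuation k E (x i j) ≤ B := by
      obtain ⟨B, hB⟩ := (Set.finite_range
        fun s : Fin f × Fin f ↦ divisionValuation k E (x s.1 s.2)).bddAbove
      exact ⟨max 1 B, le_max_left _ _, fun i j ↦ le_max_of_le_right (hB ⟨(i, j), rfl⟩)⟩
    have hB0 : B ≠ 0 := (zero_lt_one.trans_le hB1).ne'
    obtain ⟨δ, hδ0, hδ1, hδε⟩ : ∃ δ : ValueGroupWithZero k, δ ≠ 0 ∧ δ < 1 ∧ δ ≤ ε := by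
      refine ⟨min ε (divisionValuation k E (π : E)), ?_, min_lt_of_right_lt hπ, min_le_left _ _⟩
      rcases min_choice ε (divisionValuation k E (π : E)) with h | h <;> rw [h] <;> assumption
    -- Scaling by `c` multiplies the norm valuation by `valuation k c ^ finrank`; as `δ * B⁻¹ ≤ 1`,
    -- this power is at most `δ * B⁻¹`, enough to bring the bound `B` down to `δ`.
    obtain ⟨c, hc⟩ := ValuativeRel.valuation_surjective (δ * B⁻¹)
    have hc0 : c ≠ 0 := by
      rintro rfl
      rw [map_zero] at hc
      exact mul_ne_zero hδ0 (inv_ne_zero hB0) hc.symm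
    have hle : δ * B⁻¹ ≤ 1 := mul_le_one' hδ1.le (inv_le_one_of_one_le₀ hB1)
    have hsmall : ∀ i j, divisionValuation k E ((c • x) i j) ≤ δ := by
      intro i j
      rw [Matrix.smul_apply, divisionValuation_smul, hc]
      calc (δ * B⁻¹) ^ Module.finrank k E * divisionValuation k E (x i j)
          ≤ (δ * B⁻¹) * B := mul_le_mul' (pow_le_of_le_one zero_le hle Module.finrank_pos.ne')
            (hB i j)
        _ = δ := by rw [mul_assoc, inv_mul_cancel₀ hB0, mul_one]
    have hmem : c • x ∈ flagOrder R C p ε := by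
      have hD : c • x ∈ matrixOrder k E f :=
        mem_matrixOrder_iff.2 fun i j ↦ (hsmall i j).trans hδ1.le
      obtain ⟨m, hm⟩ := id hD
      refine mem_flagOrder_iff.2 ⟨⟨m, ?_, hm⟩, conj_mem_matrixOrder hC hD, fun i j _ ↦ ?_⟩
      · have : matrixReduction k E f m = 0 := by
          ext i j
          refine matrixReduction_apply_eq_zero_iff.2 (lt_of_le_of_lt ?_ hδ1)
          rw [show matrixInclusion k E f m = c • x from hm]
          exact hsmall i j
        rw [this]
        exact zero_mem _
      · refine le_trans ?_ hδε
        have := valuation_mul_matrix_le _ (valuation_mul_matrix_le _ hC.1 hsmall) hC.2 i j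
        rwa [one_mul, mul_one] at this
    have := Submodule.smul_mem _ c⁻¹ (Submodule.subset_span (R := k) hmem)
    rwa [smul_smul, inv_mul_cancel₀ hc0, one_smul] at this

/-- The products `ν U * z ^ t` with `U` invertible over the integers and `t` in `Γ`. -/
def spinorGroup {G : Type*} [CommGroup G] (𝒰 : Subgroup (Matrix (Fin f) (Fin f) E)ˣ)
    (ν : (Matrix (Fin f) (Fin f) E)ˣ →* G) (z : G) (Γ : AddSubgroup ℤ) : Subgroup G where
  carrier := {g | ∃ U ∈ 𝒰, ∃ t ∈ Γ, g = ν U * z ^ t}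
  one_mem' := ⟨1, one_mem _, 0, zero_mem _, by simp⟩
  mul_mem' := by
    rintro _ _ ⟨U, hU, t, ht, rfl⟩ ⟨V, hV, s, hs, rfl⟩
    exact ⟨U * V, mul_mem hU hV, t + s, add_mem ht hs, by
      rw [map_mul, zpow_add, mul_mul_mul_comm]⟩
  inv_mem' := by
    rintro _ ⟨U, hU, t, ht, rfl⟩
    exact ⟨U⁻¹, inv_mem hU, -t, neg_mem ht, by rw [map_inv, zpow_neg, mul_inv]⟩

/-- The values of a homomorphism to a commutative group at all elements which conjugate
a suitable flag order into `M_f(𝒪_E)`. -/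
theorem exists_conj_mem_iff_mem_spinorGroup {G : Type*} [CommGroup G]
    (ν : (Matrix (Fin f) (Fin f) E)ˣ →* G) {π : Eˣ} (hπ1 : divisionValuation k E π < 1)
    (hπ : ∀ x : Eˣ, ∃ n : ℤ, divisionValuation k E x = divisionValuation k E π ^ n)
    (hC : C ∈ integralGL (Fin f) (divisionValuation k E)) (i₀ : Fin f) (Γ : AddSubgroup ℤ) {N : ℕ}
    (hR : residualImage (flagOrder R C p (divisionValuation k E π ^ N)) = R)
    (hlow : ∀ t ∈ Γ, ∃ e : Fin f → ℤ, ∑ i, e i = t ∧ (∀ i j, p i ≤ p j → e i ≤ e j) ∧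
      ∀ i j, e i ≤ e j + N)
    (hup : ∀ (B : (Matrix (Fin f) (Fin f) (ResidueAlgebra k E))ˣ) (q : Fin f → ℤ),
      (∀ x ∈ R, ∀ i j, q i < q j →
        ((B : Matrix (Fin f) (Fin f) (ResidueAlgebra k E)) * x * (B⁻¹ : (Matrix _ _ _)ˣ)) i j
          = 0) → ∑ i, q i ∈ Γ) (g : G) :
    (∃ a : (Matrix (Fin f) (Fin f) E)ˣ, ν a = g ∧
      ∀ h ∈ flagOrder R C p (divisionValuation k E π ^ N),
        (a : Matrix (Fin f) (Fin f) E) * h * (a⁻¹ : (Matrix _ _ _)ˣ) ∈ matrixOrder k E f) ↔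
    g ∈ spinorGroup (integralGL (Fin f) (divisionValuation k E)) ν
      (ν (diagonalUnits E (Fin f) (Pi.mulSingle i₀ π))) Γ := by
  have hπ0 : divisionValuation k E (π : E) ≠ 0 := by simp
  have hconj : ∀ (e : Fin f → ℤ) (x : Matrix (Fin f) (Fin f) E) (i j : Fin f),
      divisionValuation k E (((diagonalUnits E (Fin f) fun i ↦ π ^ e i : (Matrix _ _ E)ˣ) *
        x * ((diagonalUnits E (Fin f) fun i ↦ π ^ e i)⁻¹ : (Matrix _ _ E)ˣ) :
          Matrix (Fin f) (Fin f) E) i j) =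
      divisionValuation k E π ^ (e i - e j) * divisionValuation k E (x i j) := by
    intro e x i j
    rw [diagonalUnits_conj_apply, map_mul, map_mul, Units.val_inv_eq_inv_val, map_inv₀,
      Units.val_zpow_eq_zpow_val, Units.val_zpow_eq_zpow_val, map_zpow₀, map_zpow₀,
      zpow_sub₀ hπ0, mul_right_comm, div_eq_mul_inv]
  constructor
  · rintro ⟨a, rfl, ha⟩
    obtain ⟨U, hU, V, hV, e, rfl⟩ := exists_eq_mul_diagonalUnits_mul (divisionValuation k E) hπ a
    -- `U` plays no role in the conjugation condition, since `𝔇` is stable under conjugation by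
    -- integral units.
    refine ⟨U * V, mul_mem hU hV, ∑ i, e i, ?_, ?_⟩
    · obtain ⟨v, rfl⟩ := exists_units_of_mem_integralGL hV
      refine hup (Units.map (matrixReduction k E f).toMonoidHom v) e fun x hx i j hij ↦ ?_
      rw [← hR] at hx
      obtain ⟨m, hm, rfl⟩ := mem_residualImage_iff.1 hx
      have h1 := conj_mem_matrixOrder (inv_mem hU) (ha _ hm)
      have h2 := mem_matrixOrder_iff.1 h1 i j
      have h3 : ((U⁻¹ : (Matrix (Fin f) (Fin f) E)ˣ) : Matrix (Fin f) (Fin f) E) *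
          (((U * diagonalUnits E (Fin f) (fun i ↦ π ^ e i) *
            Units.map (matrixInclusion k E f).toMonoidHom v : (Matrix (Fin f) (Fin f) E)ˣ) :
              Matrix (Fin f) (Fin f) E) * matrixInclusion k E f m *
            ((U * diagonalUnits E (Fin f) (fun i ↦ π ^ e i) *
            Units.map (matrixInclusion k E f).toMonoidHom v)⁻¹ : (Matrix (Fin f) (Fin f) E)ˣ)) *
          (U⁻¹⁻¹ : (Matrix (Fin f) (Fin f) E)ˣ) =
          (diagonalUnits E (Fin f) (fun i ↦ π ^ e i) : (Matrix (Fin f) (Fin f) E)ˣ) *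
            matrixInclusion k E f (v * m * (v⁻¹ : (Matrix _ _ _)ˣ)) *
            ((diagonalUnits E (Fin f) (fun i ↦ π ^ e i))⁻¹ : (Matrix (Fin f) (Fin f) E)ˣ) := by
        have hv : matrixInclusion k E f (v * m * (v⁻¹ : (Matrix _ _ _)ˣ)) =
            (Units.map (matrixInclusion k E f).toMonoidHom v : (Matrix (Fin f) (Fin f) E)ˣ) *
            matrixInclusion k E f m *
            ((Units.map (matrixInclusion k E f).toMonoidHom v)⁻¹ :
              (Matrix (Fin f) (Fin f) E)ˣ) := by
          rw [← map_inv, map_mul, map_mul]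
          rfl
        rw [hv, inv_inv]
        simp only [mul_inv_rev, Units.val_mul, mul_assoc, Units.inv_mul, Units.inv_mul_cancel_left,
          mul_one]
      rw [h3, hconj] at h2
      -- Conjugation by `π^e` scales this entry by `π` to the negative power `e i - e j`; the result
      -- is integral only if the entry lies in `m_E`.
      have h4 : matrixReduction k E f (v * m * (v⁻¹ : (Matrix _ _ _)ˣ)) i j = 0 := by
        rw [matrixReduction_apply_eq_zero_iff]
        by_contra! h
        have h5 : (1 : ValueGroupWithZero k) < divisionValuation k E π ^ (e i - e j) :=
          one_lt_zpow_of_neg₀ (zero_lt_iff.2 hπ0) hπ1 (by omega)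
        exact absurd h2 (not_le.2 (h5.trans_le (le_mul_of_one_le_right' h)))
      rw [← map_inv]
      rw [map_mul, map_mul] at h4
      exact h4
    · rw [map_mul, map_mul, map_mul, map_diagonalUnits_zpow ν π i₀, mul_right_comm]
  · rintro ⟨U, hU, t, ht, rfl⟩
    obtain ⟨e, rfl, hmono, hosc⟩ := hlow t ht
    -- `C` passes to the adapted basis, and its contribution to `ν` cancels.
    refine ⟨U * C⁻¹ * diagonalUnits E (Fin f) (fun i ↦ π ^ e i) * C, ?_, fun h hh ↦ ?_⟩
    · rw [map_mul, map_mul, map_mul, map_diagonalUnits_zpow ν π i₀, map_inv]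
      rw [mul_right_comm, inv_mul_cancel_right]
    · obtain ⟨-, -, hblock⟩ := mem_flagOrder_iff.1 hh
      have hCh := mem_matrixOrder_iff.1 (conj_mem_matrixOrder hC (flagOrder_le hh))
      have h1 : (diagonalUnits E (Fin f) (fun i ↦ π ^ e i) : Matrix (Fin f) (Fin f) E) *
          ((C : Matrix (Fin f) (Fin f) E) * h * (C⁻¹ : (Matrix (Fin f) (Fin f) E)ˣ)) *
          ((diagonalUnits E (Fin f) (fun i ↦ π ^ e i))⁻¹ : (Matrix (Fin f) (Fin f) E)ˣ) ∈
          matrixOrder k E f := by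
        rw [mem_matrixOrder_iff]
        intro i j
        rw [hconj]
        -- Above the blocks the factor `π ^ N` in the entry outweighs the oscillation of `e`;
        -- elsewhere monotonicity gives `e j ≤ e i`.
        rcases lt_or_ge (p i) (p j) with hij | hij
        · refine (mul_le_mul' le_rfl (hblock i j hij)).trans ?_
          rw [← zpow_natCast, ← zpow_add₀ hπ0]
          have := hosc j i
          exact zpow_le_one₀ (zero_lt_iff.2 hπ0) hπ1.le (by omega)
        · have := hmono j i hij
          exact mul_le_one' (zpow_le_one₀ (zero_lt_iff.2 hπ0) hπ1.le (by omega)) (hCh i j)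
      have h2 := conj_mem_matrixOrder (mul_mem hU (inv_mem hC)) h1
      convert h2 using 1
      simp only [mul_inv_rev, Units.val_mul, mul_assoc, inv_inv]

end FlagOrder

end LocalOrders

/-- For every residual algebra `ℍ ⊆ M_f(𝔼)` there is a local order `H ⊆ 𝔇 = M_f(𝒪_E)` of maximal
rank with image `ℍ` in `M_f(𝔼)` and whose relative local spinor image is a subgroup of `kˣ`
(`φ` is the identity representation of `k H = M_f(E)`). -/
theorem mainTheorem6 {k : Type*} [Field k] [ValuativeRel k] [TopologicalSpace k]
    [IsNonarchimedeanLocalField k]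
    {E : Type*} [DivisionRing E] [Algebra k E] [FiniteDimensional k E] [Algebra.IsCentral k E]
    (f : ℕ) (hf : 1 ≤ f)
    (ℍ : Subalgebra 𝒪[k] (Matrix (Fin f) (Fin f) (LocalOrders.ResidueAlgebra k E))) :
    ∃ H : Subalgebra 𝒪[k] (Matrix (Fin f) (Fin f) E),
      H ≤ LocalOrders.matrixOrder k E f ∧
      LocalOrders.IsLocalOrder H ∧
      LocalOrders.residualImage H = ℍ ∧
      ∃ G : Subgroup kˣ,
        (G : Set kˣ) = LocalOrders.localSpinorImage
          (AlgHom.id k (Matrix (Fin f) (Fin f) E)) (LocalOrders.matrixOrder k E f) H := by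
  -- Provides the index `0` at which the reference matrix `diag(π, 1, …, 1)` carries its `π`, and
  -- the nonempty index type for the weights.
  have : NeZero f := ⟨by omega⟩
  obtain ⟨π, hπ1, hπ⟩ := LocalOrders.exists_uniformizer k E
  obtain ⟨B, p, hB, hup⟩ := LocalOrders.exists_adapted_unit_of_isUnit_or_eq_zero
    (LocalOrders.residueAlgebra_isUnit_or_eq_zero (k := k) (E := E)) (ℍ : Set (Matrix (Fin f) (Fin f) _))
  obtain ⟨N, hlow⟩ := LocalOrders.exists_monotone_weights p
  obtain ⟨c, rfl⟩ := LocalOrders.exists_units_lift B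
  have hc := LocalOrders.units_map_matrixInclusion_mem c
  have himage := LocalOrders.residualImage_flagOrder (R := ℍ) (p := p)
    (ε := LocalOrders.divisionValuation k E π ^ N) (c := c) hB
  obtain ⟨ν, hν⟩ := LocalOrders.exists_unitsHom_isReducedNorm_iff k (Matrix (Fin f) (Fin f) E)
  have key := LocalOrders.exists_conj_mem_iff_mem_spinorGroup ν hπ1 hπ hc 0 _ himage hlow hup
  -- The group of values lives in the units of the algebraic closure; the spinor image is its
  -- preimage in `kˣ`.
  refine ⟨_, LocalOrders.flagOrder_le, LocalOrders.isLocalOrder_flagOrder hc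
    (pow_ne_zero N (by simp)), himage, Subgroup.comap
    (Units.map (algebraMap k (AlgebraicClosure k)).toMonoidHom)
    (LocalOrders.spinorGroup (LocalOrders.integralGL (Fin f) (LocalOrders.divisionValuation k E)) ν
      (ν (LocalOrders.diagonalUnits E (Fin f) (Pi.mulSingle 0 π)))
      (AddSubgroup.closure
        (Set.range fun n ↦ ((Finset.univ.filter fun j ↦ p j < n).card : ℤ)))),
    Set.ext fun r ↦ (key _).symm.trans (exists_congr fun a ↦ and_congr (hν a r).symm Iff.rfl)⟩
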